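/- Let $\ell,m,n$ be positive integers, let $r$ be a positive integer or $\infty$, let $N$ be a non-empty $C^r$ manifold of dimension $n$ (without boundary, Hausdorff, with a countable base), let $U\subset\mathbb{R}^m$ be open, let $f:N\to U$ be an injective $C^r$ mapping and let $F:U\to\mathbb{R}^\ell$ be a $C^r$ mapping. For a linear mapping $\pi:\mathbb{R}^m\to\mathbb{R}^\ell$ set $F_\pi=F+\pi|_U$. Let $\mathcal{L}(\mathbb{R}^m,\mathbb{R}^\ell)$ be the space of all linear mappings $\mathbb{R}^m\to\mathbb{R}^\ell$, identified with $(\mathbb{R}^m)^\ell$ through representing matrices. For $s\ge 1$ let $N^{(s)}=\{(q_1,\dots,q_s)\in N^s : q_i\ne q_j \text{ for } i\neq j\}$, an open submanifold of $N^s$. For $g:N\to\mathbb{R}^\ell$ let $g^{(s)}:N^{(s)}\to(\mathbb{R}^\ell)^s$, $g^{(s)}(q_1,\dots,q_s)=(g(q_1),\dots,g(q_s))$, and let $\Delta_s=\{(y,\dots,y) : y\in\mathbb{R}^\ell\}\subset(\mathbb{R}^\ell)^s$. A $C^1$ mapping $h:M\to P$ of manifolds is transverse to a submanifold $Z\subset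 P$ if $dh_q(T_qM)+T_{h(q)}Z=T_{h(q)}P$ for every $q\in M$ with $h(q)\in Z$. A $C^1$ mapping $g:N\to\mathbb{R}^\ell$ has normal crossings if $g^{(s)}$ is transverse to $\Delta_s$ for every $s\ge2$. Set $$s_f=\max\Big\{s\ge 1 : \forall (q_1,\dots,q_s)\in N^{(s)},\ \dim\sum_{i=2}^s\mathbb{R}\,(f(q_i)-f(q_1))=s-1\Big\}$$ (this maximum exists and $2\le s_f\le m+1$) and $$s_0=\max\{s(n-\ell)+\ell : 2\le s\le s_f\}.$$ **Theorem.** If $r>\max\{s_0,0\}$, then there is a subset $\Sigma$ of $\mathcal{L}(\mathbb{R}^m,\mathbb{R}^\ell)$ with Lebesgue measure zero such that for every $\pi\in\mathcal{L}(\mathbb{R}^m,\mathbb{R}^\ell)\setminus\Sigma$: 1. for every $s$ with $2\le s\le s_f$, the mapping $(F_\pi\circ f)^{(s)}:N^{(s)}\to(\mathbb{R}^\ell)^s$ is of class $C^r$ and transverse to $\Delta_s$; 2. if moreover $|F_\pi^{-1}(y)|\le s_f$ for every $y\in\mathbb{R}^\ell$, then $F_\pi\circ f:N\to\mathbb{R}^\ell$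 is a $C^r$ mapping with normal crossings. -/

import Mathlib

open scoped Manifold ContDiff

/- A vector space is always charted by itself through the identity (this instance would otherwise
be found first for a space that is its own model; it is definitionally the same). -/
attribute [-instance] TopCat.of.chartedSpace

noncomputable section

namespace LinearPerturbation

/-- The Euclidean space `ℝ^k`. -/
abbrev E (k : ℕ) : Type := EuclideanSpace ℝ (Fin k)

/-! ### Transversality -/

/-- The tangent space `T_z Z ⊆ T_z V = V` of a submanifold `Z` of a normed space `V`: the subspace
spanned by the velocities at `0` of the `C^1` curves in `Z` that pass through `z` at time `0`. -/
def tangentSpaceOf {V : Type*} [NormedAddCommGroup V] [NormedSpace ℝ V]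
    (Z : Set V) (z : V) : Submodule ℝ (TangentSpace 𝓘(ℝ, V) z) :=
  Submodule.span ℝ
    {v : V | ∃ γ : ℝ → V, ContDiff ℝ 1 γ ∧ (∀ t, γ t ∈ Z) ∧ γ 0 = z ∧ deriv γ 0 = v}

/-- The mapping `g : M → V` is transverse to the submanifold `Z` of `V`: at every `q` with
`g q ∈ Z` one has `dg_q (T_q M) + T_{g q} Z = T_{g q} V`. -/
def IsTransverse {B H M V : Type*} [NormedAddCommGroup B] [NormedSpace ℝ B] [TopologicalSpace H]
    (I : ModelWithCorners ℝ B H) [TopologicalSpace M] [ChartedSpace H M]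
    [NormedAddCommGroup V] [NormedSpace ℝ V] (g : M → V) (Z : Set V) : Prop :=
  ∀ q : M, g q ∈ Z →
    LinearMap.range (mfderiv I 𝓘(ℝ, V) g q).toLinearMap ⊔ tangentSpaceOf Z (g q) = ⊤

/-! ### Multi-maps and normal crossings -/

/-- `N^{(s)}`, the open submanifold of `N^s` of `s`-tuples of pairwise distinct points. -/
def distinctTuples (N : Type*) [TopologicalSpace N] [T2Space N] (s : ℕ) :
    TopologicalSpace.Opens (Fin s → N) where
  carrier := {q | ∀ i j, i ≠ j → q i ≠ q j}
  is_open' := by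
    simp only [Set.ofPred_forall]
    exact isOpen_iInter_of_finite fun i => isOpen_iInter_of_finite fun j =>
      isOpen_iInter_of_finite fun _ =>
        isOpen_ne_fun (continuous_apply i) (continuous_apply j)

/-- The multi-map `g^{(s)} : N^{(s)} → (ℝ^ℓ)^s`, `(q_1, …, q_s) ↦ (g q_1, …, g q_s)`. -/
def multiMap {N : Type*} [TopologicalSpace N] [T2Space N] {l : ℕ} (g : N → E l) (s : ℕ) :
    distinctTuples N s → (Fin s → E l) :=
  fun q i => g (q.1 i)

/-- The diagonal `Δ_s = {(y, …, y)}` of `(ℝ^ℓ)^s`. -/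
def diagonal (l s : ℕ) : Set (Fin s → E l) :=
  {z | ∃ y : E l, z = fun _ => y}

/-- The model with corners of `N^s` (and of its open subset `N^{(s)}`) for an `n`-dimensional
manifold `N` without boundary. -/
abbrev powModel (n s : ℕ) := ModelWithCorners.pi (fun _ : Fin s => 𝓡 n)

/-- A `C^1` mapping `g : N → ℝ^ℓ` has normal crossings if `g^{(s)}` is transverse to `Δ_s` for
every `s ≥ 2`. -/
def HasNormalCrossings {n l : ℕ} {N : Type*} [TopologicalSpace N] [T2Space N]
    [ChartedSpace (E n) N] (g : N → E l) : Prop :=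
  ContMDiff (𝓡 n) 𝓘(ℝ, E l) 1 g ∧
    ∀ s : ℕ, 2 ≤ s → IsTransverse (powModel n s) (multiMap g s) (diagonal l s)

/-! ### The numbers `s_f` and `s_0` -/

/-- The set of the positive integers `s` such that for all pairwise distinct `q_1, …, q_s` in `N`
the vectors `f q_i - f q_1` (`2 ≤ i ≤ s`) span a space of dimension `s - 1`. -/
def generalPositionSet {N : Type*} {m : ℕ} (f : N → E m) : Set ℕ :=
  {s | ∃ hs : 0 < s, ∀ q : Fin s → N, (∀ i j, i ≠ j → q i ≠ q j) →
    Module.finrank ℝ (Submodule.span ℝ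
      ((fun i : Fin s => f (q i) - f (q ⟨0, hs⟩)) '' {i | i ≠ ⟨0, hs⟩})) = s - 1}

/-- `s_f`, the maximum of `generalPositionSet f`. -/
def sMax {N : Type*} {m : ℕ} (f : N → E m) : ℕ :=
  sSup (generalPositionSet f)

/-- The set whose supremum is `s_f` is non-empty and bounded above by `m + 1` as soon as `N` is
infinite (as every non-empty manifold of positive dimension is), so `s_f` is a maximum. -/
theorem isGreatest_sMax {N : Type*} [Infinite N] {m : ℕ} (f : N → E m) :
    IsGreatest (generalPositionSet f) (sMax f) ∧ sMax f ≤ m + 1 := by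
  have hb : ∀ s ∈ generalPositionSet f, s ≤ m + 1 := by
    rintro s ⟨hs, h⟩
    have h1 := h (fun i => Infinite.natEmbedding N i)
      (fun i j hij h' => hij (Fin.ext ((Infinite.natEmbedding N).injective h')))
    have h2 := Submodule.finrank_le (Submodule.span ℝ
      ((fun i : Fin s => f (Infinite.natEmbedding N i) - f (Infinite.natEmbedding N 0)) ''
        {i | i ≠ ⟨0, hs⟩}))
    rw [finrank_euclideanSpace_fin] at h2
    have h3 : s - 1 ≤ m := h1 ▸ h2
    omega
  have hne : (generalPositionSet f).Nonempty := by
    refine ⟨1, one_pos, fun q _ => ?_⟩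
    have : ({i | i ≠ ⟨0, one_pos⟩} : Set (Fin 1)) = ∅ := by
      ext i; simp [Subsingleton.elim i 0]
    rw [this]; simp
  exact ⟨⟨Nat.sSup_mem hne ⟨m + 1, hb⟩, fun s hs => le_csSup ⟨m + 1, hb⟩ hs⟩, csSup_le hne hb⟩

/-- The integer `s_0 = max {s (n - ℓ) + ℓ ∣ 2 ≤ s ≤ s_f}`, for `sf = s_f ≥ 2`. -/
def sZero (n l sf : ℕ) : ℤ :=
  sSup ((fun s : ℕ => (s : ℤ) * ((n : ℤ) - (l : ℤ)) + (l : ℤ)) '' Set.Icc 2 sf)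

/-! ### Null sets of linear mappings -/

/-- The identification of the space of linear mappings `ℝ^m → ℝ^ℓ` with `(ℝ^m)^ℓ` through the
representing matrix. -/
def coefficients {m l : ℕ} (π : E m →ₗ[ℝ] E l) : Fin l → Fin m → ℝ :=
  fun i j => π (EuclideanSpace.single j 1) i

/-- A set of linear mappings `ℝ^m → ℝ^ℓ` has Lebesgue measure zero. -/
def IsLebesgueNull {m l : ℕ} (S : Set (E m →ₗ[ℝ] E l)) : Prop :=
  MeasureTheory.volume (coefficients '' S) = 0

end LinearPerturbation

end

/-! Put `s = t + 1`. The mapping `g^{(s)}` is transverse to the diagonal as soon as zero is a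
regular value of the differences `(g q_i - g q_0)_{1 ≤ i ≤ t}`. For `g = F_π ∘ f` these equal a
fixed mapping plus `(π b_i)_i` with `b_i = f q_i - f q_0`. For `s ≤ s_f` the `b_i` are linearly
independent, so `π ↦ (π b_i)_i` is onto `(ℝ^ℓ)^t`, and parametric transversality
(`isNull_setOf_exists_critical_zero`) makes the bad `π` a null set. It reduces to Sard's theorem for
a mapping whose dimensions differ by `s n - (s - 1) ℓ = s (n - ℓ) + ℓ ≤ s_0`; this is why `r > max
{s_0, 0}` suffices. For `s > s_f` the bound on the fibres of `F_π` keeps `g^{(s)}` away from the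
diagonal.

Sard's theorem is needed in its sharp differentiability class (`isNull_criticalValues`). Points of
non-zero derivative are handled by straightening one coordinate, Fubini and induction on the
dimension of the target. Points of zero derivative rest on a covering result in the manner of A. P.
Morse (`hasFlatCover_self`): any set `A` is a countable union of pieces along which every `C^k`
function vanishing on `A` is `o(dist^k)`. Applied to the derivative, this makes the mapping itself
`o(dist^(k+1))`, and a Hausdorff measure estimate shows that its image is null. -/

noncomputable section

namespace LinearPerturbation

open Set Filter Topology MeasureTheory Module
open scoped Uniformity

universe u v w

/-! ### Straightening a function with non-zero derivative -/

section Straightening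

variable {V : Type u} [NormedAddCommGroup V] [NormedSpace ℝ V]

/-- The linear isomorphism `V ≃ ℝ × ker φ` given by a functional `φ` and a vector `v` with
`φ v = 1`. -/
def splitByFunctional (φ : V →L[ℝ] ℝ) (v : V) (hv : φ v = 1) :
    V ≃ₗ[ℝ] ℝ × LinearMap.ker (φ : V →ₗ[ℝ] ℝ) where
  toFun x := (φ x, ⟨x - φ x • v, by simp [hv]⟩)
  invFun p := p.1 • v + p.2
  map_add' x y := by
    ext
    · simp
    · simp [add_smul]; abel
  map_smul' c x := by
    ext
    · simp
    · simp [smul_sub, mul_smul]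
  left_inv x := by simp
  right_inv p := by
    have h : φ (p.2 : V) = 0 := p.2.2
    ext
    · simp [hv, h]
    · simp [hv, h]

theorem exists_apply_eq_one {φ : V →L[ℝ] ℝ} (h : φ ≠ 0) : ∃ v, φ v = 1 := by
  obtain ⟨w, hw⟩ : ∃ w, φ w ≠ 0 := by
    by_contra! hc
    exact h (ContinuousLinearMap.ext hc)
  exact ⟨(φ w)⁻¹ • w, by simp [hw]⟩

/-- Near a point where its derivative does not vanish, a `C^k` function is the first coordinate
of a `C^k` chart. -/
theorem exists_straightening [FiniteDimensional ℝ V] {k : ℕ} (hk : k ≠ 0) {U : Set V}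
    (hU : IsOpen U) {g : V → ℝ} (hg : ContDiffOn ℝ k g U) {x : V} (hx : x ∈ U)
    (h : fderiv ℝ g x ≠ 0) :
    ∃ Z : Submodule ℝ V, finrank ℝ Z + 1 = finrank ℝ V ∧
      ∃ e : OpenPartialHomeomorph V (ℝ × Z), x ∈ e.source ∧ e.source ⊆ U ∧
        (∀ y ∈ e.source, (e y).1 = g y) ∧ ContDiffOn ℝ k e.symm e.target := by
  have hk' : ((k : ℕ∞) : WithTop ℕ∞) ≠ 0 := by exact_mod_cast hk
  have hk1 : (1 : WithTop ℕ∞) ≤ k := by exact_mod_cast Nat.one_le_iff_ne_zero.2 hk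
  set φ := fderiv ℝ g x
  obtain ⟨v, hv⟩ := exists_apply_eq_one h
  let L := (splitByFunctional φ v hv).toContinuousLinearEquiv
  let p : V →L[ℝ] LinearMap.ker (φ : V →ₗ[ℝ] ℝ) :=
    (ContinuousLinearMap.snd ℝ ℝ _).comp (L : V →L[ℝ] ℝ × LinearMap.ker (φ : V →ₗ[ℝ] ℝ))
  refine ⟨LinearMap.ker (φ : V →ₗ[ℝ] ℝ), ?_, ?_⟩
  · have := L.toLinearEquiv.finrank_eq
    rw [finrank_prod, finrank_self] at this
    omega
  -- Since `p` is the second component of `L`, the derivative of `Φ` at `x` is `L` itself, and the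
  -- inverse function theorem applies.
  let Φ : V → ℝ × LinearMap.ker (φ : V →ₗ[ℝ] ℝ) := fun y => (g y, p y)
  have hΦ : ContDiffOn ℝ k Φ U := hg.prodMk p.contDiff.contDiffOn
  have hΦx : ContDiffAt ℝ k Φ x := hΦ.contDiffAt (hU.mem_nhds hx)
  have hgx : HasFDerivAt g φ x :=
    ((hg.contDiffAt (hU.mem_nhds hx)).differentiableAt hk').hasFDerivAt
  have hΦ' : HasFDerivAt Φ (L : V →L[ℝ] ℝ × LinearMap.ker (φ : V →ₗ[ℝ] ℝ)) x :=
    hgx.prodMk p.hasFDerivAt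
  let e₀ := hΦx.toOpenPartialHomeomorph Φ hΦ' hk'
  have hdc : ContinuousOn (fderiv ℝ Φ) U := hΦ.continuousOn_fderiv_of_isOpen hU hk1
  -- Keeping only points with invertible derivative makes the inverse `C^k` on the whole target, not
  -- just near the image of `x`.
  have hs : IsOpen (U ∩ fderiv ℝ Φ ⁻¹' range
      ((↑) : (V ≃L[ℝ] ℝ × LinearMap.ker (φ : V →ₗ[ℝ] ℝ)) → _)) :=
    hdc.isOpen_inter_preimage hU ContinuousLinearEquiv.isOpen
  refine ⟨e₀.restrOpen _ hs, ?_, ?_, ?_, ?_⟩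
  · rw [OpenPartialHomeomorph.restrOpen_source]
    exact ⟨hΦx.mem_toOpenPartialHomeomorph_source hΦ' hk', hx, L, hΦ'.fderiv.symm⟩
  · rw [OpenPartialHomeomorph.restrOpen_source]
    exact fun y hy => hy.2.1
  · intro y _
    rfl
  · intro q hq
    have hy := (e₀.restrOpen _ hs).map_target hq
    rw [OpenPartialHomeomorph.restrOpen_source] at hy
    obtain ⟨M, hM⟩ := hy.2.2
    have hd : ContDiffAt ℝ k Φ ((e₀.restrOpen _ hs).symm q) :=
      hΦ.contDiffAt (hU.mem_nhds hy.2.1)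
    refine ((e₀.restrOpen _ hs).contDiffAt_symm hq (f₀' := M) ?_ hd).contDiffWithinAt
    rw [hM]
    exact (hd.differentiableAt hk').hasFDerivAt

end Straightening

/-! ### Flat functions -/

section Flat

variable {W F : Type*} [NormedAddCommGroup W] [NormedAddCommGroup F]

/-- `h y - h x = o(‖y - x‖ ^ k)`, uniformly for `x ∈ D` and `y ∈ B`. -/
def IsFlat (k : ℕ) (D B : Set W) (h : W → F) : Prop :=
  (fun p : W × W => h p.2 - h p.1) =o[𝓤 W ⊓ 𝓟 (D ×ˢ B)] fun p => dist p.1 p.2 ^ k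

theorem IsFlat.exists_forall {k : ℕ} {D B : Set W} {h : W → F} (hh : IsFlat k D B h) {c : ℝ}
    (hc : 0 < c) : ∃ δ > 0, ∀ x ∈ D, ∀ y ∈ B, dist x y < δ →
      ‖h y - h x‖ ≤ c * dist x y ^ k := by
  have h1 := hh.def hc
  rw [eventually_inf_principal, Metric.uniformity_basis_dist.eventually_iff] at h1
  obtain ⟨δ, hδ, H⟩ := h1
  refine ⟨δ, hδ, fun x hx y hy hxy => ?_⟩
  have := H (show (x, y) ∈ {p : W × W | dist p.1 p.2 < δ} from hxy) ⟨hx, hy⟩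
  simpa [abs_of_nonneg] using this

theorem isFlat_of_exists_forall {k : ℕ} {D B : Set W} {h : W → F}
    (H : ∀ c > 0, ∃ δ > 0, ∀ x ∈ D, ∀ y ∈ B, dist x y < δ →
      ‖h y - h x‖ ≤ c * dist x y ^ k) : IsFlat k D B h := by
  refine Asymptotics.IsLittleO.of_bound fun c hc => ?_
  rw [eventually_inf_principal, Metric.uniformity_basis_dist.eventually_iff]
  obtain ⟨δ, hδ, H⟩ := H c hc
  refine ⟨δ, hδ, fun p hp hpD => ?_⟩
  have := H p.1 hpD.1 p.2 hpD.2 hp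
  simpa [abs_of_nonneg] using this

theorem isFlat_zero {D B : Set W} {h : W → F} (hB : IsCompact B) (hD : D ⊆ B)
    (hh : ContinuousOn h B) : IsFlat 0 D B h := by
  have := hB.uniformContinuousOn_of_continuous hh
  rw [Metric.uniformContinuousOn_iff] at this
  refine isFlat_of_exists_forall fun c hc => ?_
  obtain ⟨δ, hδ, H⟩ := this c hc
  refine ⟨δ, hδ, fun x hx y hy hxy => ?_⟩
  have := H x (hD hx) y hy hxy
  rw [dist_comm, dist_eq_norm] at this
  simpa using this.le

/-- Flatness of a mapping into a finite-dimensional space can be checked on functionals. -/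
theorem isFlat_of_forall_dual [NormedSpace ℝ F] [FiniteDimensional ℝ F] {k : ℕ} {D B : Set W}
    {h : W → F}
    (H : ∀ φ : F →L[ℝ] ℝ, IsFlat k D B fun x => φ (h x)) : IsFlat k D B h := by
  let e : F ≃L[ℝ] (Fin (finrank ℝ F) → ℝ) := ContinuousLinearEquiv.ofFinrankEq (by simp)
  have h1 : (fun p : W × W => e (h p.2 - h p.1)) =o[𝓤 W ⊓ 𝓟 (D ×ˢ B)]
      fun p => dist p.1 p.2 ^ k := by
    rw [Asymptotics.isLittleO_pi]
    intro i
    have := H ((ContinuousLinearMap.proj i).comp (e : F →L[ℝ] (Fin (finrank ℝ F) → ℝ)))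
    refine this.congr_left fun p => ?_
    simp
  exact ((e.isBigO_comp_rev _ _).trans_isLittleO h1)

/-- Integration of flatness: if the derivative of `g` is flat of order `k` along `ψ` and vanishes
on `ψ '' D`, then `g` is flat of order `k + 1` along `ψ`. -/
theorem IsFlat.of_fderiv {V : Type*} [NormedAddCommGroup V] [NormedSpace ℝ V] [NormedSpace ℝ W]
    [NormedSpace ℝ F] {k : ℕ} {U : Set V} (hU : IsOpen U) {g : V → F}
    (hg : DifferentiableOn ℝ g U) {O B D : Set W} {ψ : W → V} (hO : IsOpen O) (hB : IsCompact B)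
    (hBc : Convex ℝ B) (hBO : B ⊆ O) (hDB : D ⊆ B) (hψ : ContDiffOn ℝ 1 ψ O)
    (hψU : MapsTo ψ O U) (h0 : ∀ x ∈ D, fderiv ℝ g (ψ x) = 0)
    (hflat : IsFlat k D B fun x => fderiv ℝ g (ψ x)) : IsFlat (k + 1) D B (g ∘ ψ) := by
  obtain ⟨L, hL⟩ := hB.exists_bound_of_continuousOn
    ((hψ.continuousOn_fderiv_of_isOpen hO le_rfl).mono hBO)
  have hL' : 0 < |L| + 1 := by positivity
  refine isFlat_of_exists_forall fun c hc => ?_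
  obtain ⟨δ, hδ, H⟩ := hflat.exists_forall (div_pos hc hL')
  refine ⟨δ, hδ, fun x hx y hy hxy => ?_⟩
  have hconv : Convex ℝ (segment ℝ x y) := convex_segment x y
  have hseg : segment ℝ x y ⊆ B := hBc.segment_subset (hDB hx) hy
  -- The derivative of `g ∘ ψ` is at most `c * dist x y ^ k` on the whole segment, because that of
  -- `g` vanishes at `ψ x`; the mean value inequality adds one power of the distance.
  have key := hconv.norm_image_sub_le_of_norm_hasFDerivWithin_le (f := g ∘ ψ)
    (f' := fun z => (fderiv ℝ g (ψ z)).comp (fderiv ℝ ψ z))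
    (C := c * dist x y ^ k) (x := x) (y := y) ?_ ?_ (left_mem_segment ℝ x y)
    (right_mem_segment ℝ x y)
  · rw [← dist_eq_norm y x, dist_comm y x] at key
    rw [pow_succ, ← mul_assoc]
    exact key
  · intro z hz
    have hzO := hBO (hseg hz)
    have h1 : HasFDerivAt ψ (fderiv ℝ ψ z) z :=
      ((hψ.contDiffAt (hO.mem_nhds hzO)).differentiableAt one_ne_zero).hasFDerivAt
    have h2 : HasFDerivAt g (fderiv ℝ g (ψ z)) (ψ z) :=
      (hg.differentiableAt (hU.mem_nhds (hψU hzO))).hasFDerivAt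
    exact (h2.comp z h1).hasFDerivWithinAt
  · intro z hz
    have hd : dist x z ≤ dist x y := by
      rw [dist_comm x z, dist_comm x y, dist_eq_norm, dist_eq_norm]
      exact norm_sub_le_of_mem_segment hz
    have h1 := H x hx z (hseg hz) (hd.trans_lt hxy)
    rw [h0 x hx, sub_zero] at h1
    calc ‖(fderiv ℝ g (ψ z)).comp (fderiv ℝ ψ z)‖
        ≤ ‖fderiv ℝ g (ψ z)‖ * ‖fderiv ℝ ψ z‖ := ContinuousLinearMap.opNorm_comp_le _ _
      _ ≤ (c / (|L| + 1) * dist x y ^ k) * (|L| + 1) := by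
          gcongr
          · exact h1.trans (by gcongr)
          · exact (hL z (hseg hz)).trans ((le_abs_self L).trans (by linarith))
      _ = c * dist x y ^ k := by field_simp

end Flat

/-! ### Flat covers -/

section FlatCover

/-- `P` is contained in the image of a subset `D` of a compact convex set `B` under a `C^1` mapping
`ψ` into `U`, defined near `B` in a space of dimension at most `dim V`, along which every `C^k`
function on `U` that vanishes on `A` is flat of order `k`. -/
def IsFlatPiece {V : Type u} [NormedAddCommGroup V] [NormedSpace ℝ V]
    (k : ℕ) (U A P : Set V) : Prop :=
  ∃ (W : Type u) (_ : NormedAddCommGroup W) (_ : NormedSpace ℝ W) (_ : FiniteDimensional ℝ W)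
    (O B D : Set W) (ψ : W → V), finrank ℝ W ≤ finrank ℝ V ∧ IsOpen O ∧ IsCompact B ∧
    Convex ℝ B ∧ B ⊆ O ∧ D ⊆ B ∧ ContDiffOn ℝ 1 ψ O ∧ MapsTo ψ O U ∧ P ⊆ ψ '' D ∧
    ψ '' D ⊆ A ∧ ∀ g : V → ℝ, ContDiffOn ℝ k g U → (∀ x ∈ A, g x = 0) → IsFlat k D B (g ∘ ψ)

/-- `A'` is covered by countably many flat pieces. -/
def HasFlatCover {V : Type u} [NormedAddCommGroup V] [NormedSpace ℝ V]
    (k : ℕ) (U A A' : Set V) : Prop :=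
  ∃ S : Set (Set V), S.Countable ∧ A' ⊆ ⋃₀ S ∧ ∀ P ∈ S, IsFlatPiece k U A P

variable {V : Type u} [NormedAddCommGroup V] [NormedSpace ℝ V]

theorem HasFlatCover.union {k : ℕ} {U A A' A'' : Set V} (h' : HasFlatCover k U A A')
    (h'' : HasFlatCover k U A A'') : HasFlatCover k U A (A' ∪ A'') := by
  obtain ⟨S, hS, hc, hp⟩ := h'
  obtain ⟨S', hS', hc', hp'⟩ := h''
  refine ⟨S ∪ S', hS.union hS', ?_, ?_⟩
  · rw [sUnion_union]; exact union_subset_union hc hc'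
  · rintro P (h | h)
    exacts [hp P h, hp' P h]

theorem hasFlatCover_of_locally [FiniteDimensional ℝ V] {k : ℕ} {U A A' : Set V}
    (h : ∀ x ∈ A', ∃ s ∈ 𝓝 x, HasFlatCover k U A (A' ∩ s)) : HasFlatCover k U A A' := by
  have : ∀ x, ∃ s : Set V, (x ∈ A' → s ∈ 𝓝 x) ∧ HasFlatCover k U A (A' ∩ s) := by
    intro x
    by_cases hx : x ∈ A'
    · obtain ⟨s, hs, H⟩ := h x hx
      exact ⟨s, fun _ => hs, H⟩
    · exact ⟨∅, fun h => (hx h).elim, ∅, countable_empty, by simp, by simp⟩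
  choose s hs S hSc hS hP using this
  obtain ⟨t, _, htc, ht⟩ := TopologicalSpace.countable_cover_nhdsWithin
    (f := s) (s := A') fun x hx => mem_nhdsWithin_of_mem_nhds (hs x hx)
  refine ⟨⋃ x ∈ t, S x, htc.biUnion fun x _ => hSc x, ?_, ?_⟩
  · intro y hy
    obtain ⟨x, hx, hyx⟩ := mem_iUnion₂.1 (ht hy)
    obtain ⟨P, hP, hyP⟩ := hS x ⟨hy, hyx⟩
    exact ⟨P, mem_iUnion₂.2 ⟨x, hx, hP⟩, hyP⟩
  · intro P hP'
    obtain ⟨x, _, hx⟩ := mem_iUnion₂.1 hP'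
    exact hP x P hx

theorem hasFlatCover_zero [FiniteDimensional ℝ V] {U A : Set V} (hU : IsOpen U) (hA : A ⊆ U) :
    HasFlatCover 0 U A A := by
  refine hasFlatCover_of_locally fun x hx => ?_
  obtain ⟨ρ, hρ, hball⟩ := Metric.isOpen_iff.1 hU x (hA hx)
  have hsub : Metric.closedBall x (ρ / 2) ⊆ Metric.ball x ρ :=
    Metric.closedBall_subset_ball (by linarith)
  refine ⟨Metric.closedBall x (ρ / 2), Metric.closedBall_mem_nhds x (by linarith),
    {A ∩ Metric.closedBall x (ρ / 2)}, countable_singleton _, by simp, ?_⟩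
  rintro _ rfl
  refine ⟨V, _, _, ‹_›, Metric.ball x ρ, Metric.closedBall x (ρ / 2),
    A ∩ Metric.closedBall x (ρ / 2), id, le_rfl, Metric.isOpen_ball,
    isCompact_closedBall x _, convex_closedBall x _, hsub, inter_subset_right,
    contDiff_id.contDiffOn, hball, by simp, by simp, fun g hg _ => ?_⟩
  exact isFlat_zero (isCompact_closedBall x _) inter_subset_right
    (hg.continuousOn.mono (hsub.trans hball))

/-- The points of `A` at which the derivative of every `C^k` function on `U` vanishing on `A`
vanishes. -/
def criticalPart (k : ℕ) (U A : Set V) : Set V :=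
  {x ∈ A | ∀ g : V → ℝ, ContDiffOn ℝ k g U → (∀ y ∈ A, g y = 0) → fderiv ℝ g x = 0}

/-- By definition of `criticalPart`, the components of the derivative of `g` are `C^k` functions
vanishing there, hence flat of order `k`; integration gains one order. -/
theorem IsFlatPiece.succ [FiniteDimensional ℝ V] {k : ℕ} {U A P : Set V} (hU : IsOpen U)
    (h : IsFlatPiece k U (criticalPart (k + 1 : ℕ) U A) P) : IsFlatPiece (k + 1) U A P := by
  obtain ⟨W, i₁, i₂, i₃, O, B, D, ψ, hfr, hO, hB, hBc, hBO, hDB, hψ, hψU, hP, hDA, H⟩ := h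
  refine ⟨W, i₁, i₂, i₃, O, B, D, ψ, hfr, hO, hB, hBc, hBO, hDB, hψ, hψU, hP,
    hDA.trans fun x hx => hx.1, fun g hg hgA => ?_⟩
  refine IsFlat.of_fderiv hU (hg.differentiableOn (by simp)) hO hB hBc hBO hDB hψ hψU
    (fun x hx => (hDA (mem_image_of_mem ψ hx)).2 g hg hgA) ?_
  refine isFlat_of_forall_dual fun φ => ?_
  refine H (fun x => φ (fderiv ℝ g x)) ?_ ?_
  · refine φ.contDiff.comp_contDiffOn (hg.fderiv_of_isOpen hU ?_)
    exact_mod_cast le_rfl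
  · intro x hx
    simp [hx.2 g hg hgA]

theorem HasFlatCover.succ [FiniteDimensional ℝ V] {k : ℕ} {U A A' : Set V} (hU : IsOpen U)
    (h : HasFlatCover k U (criticalPart (k + 1 : ℕ) U A) A') : HasFlatCover (k + 1) U A A' := by
  obtain ⟨S, hS, hc, hp⟩ := h
  exact ⟨S, hS, hc, fun P hP => (hp P hP).succ hU⟩

/-- Flat pieces are preserved by `C^k` parametrizations. -/
theorem IsFlatPiece.image {Z : Type u} [NormedAddCommGroup Z] [NormedSpace ℝ Z]
    (hZ : finrank ℝ Z ≤ finrank ℝ V) {k : ℕ} (hk : k ≠ 0) {U A : Set V} {U' A' P : Set Z}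
    {φ : Z → V} (hφ : ContDiffOn ℝ k φ U') (hφU : MapsTo φ U' U) (hφA : MapsTo φ A' A)
    (h : IsFlatPiece k U' A' P) : IsFlatPiece k U A (φ '' P) := by
  obtain ⟨W, i₁, i₂, i₃, O, B, D, ψ, hfr, hO, hB, hBc, hBO, hDB, hψ, hψU, hP, hDA, H⟩ := h
  have hk1 : (1 : WithTop ℕ∞) ≤ k := by exact_mod_cast Nat.one_le_iff_ne_zero.2 hk
  refine ⟨W, i₁, i₂, i₃, O, B, D, φ ∘ ψ, hfr.trans hZ, hO, hB, hBc, hBO, hDB,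
    (hφ.of_le hk1).comp hψ hψU, hφU.comp hψU, ?_, ?_, fun g hg hgA => ?_⟩
  · rw [image_comp]; exact image_mono hP
  · rw [image_comp]; exact (image_mono hDA).trans hφA.image_subset
  · exact H (g ∘ φ) (hg.comp hφ hφU) fun x hx => hgA _ (hφA hx)

/-- Induction on `dim V` and on `k`. The critical part of `A` is covered at order `k` and gains one
order by `HasFlatCover.succ`. Near any other point, `A` lies on a hypersurface `g = 0` with non-zero
derivative, which is parametrized by an open set in one dimension less. -/
theorem hasFlatCover_self [FiniteDimensional ℝ V] (k : ℕ) {U A : Set V} (hU : IsOpen U)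
    (hA : A ⊆ U) : HasFlatCover k U A A := by
  induction hd : finrank ℝ V using Nat.strong_induction_on generalizing V k with
  | _ d ihd =>
  induction k generalizing A with
  | zero => exact hasFlatCover_zero hU hA
  | succ k ihk =>
  set A₁ := criticalPart (k + 1 : ℕ) U A
  have hA₁ : A₁ ⊆ A := fun x hx => hx.1
  suffices HasFlatCover (k + 1) U A (A₁ ∪ A \ A₁) by rwa [union_sdiff_cancel hA₁] at this
  refine HasFlatCover.union ((ihk (hA₁.trans hA)).succ hU) ?_
  refine hasFlatCover_of_locally fun x hx => ?_
  obtain ⟨g, hg, hgA, hgx⟩ : ∃ g : V → ℝ, ContDiffOn ℝ (k + 1 : ℕ) g U ∧ (∀ y ∈ A, g y = 0) ∧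
      fderiv ℝ g x ≠ 0 := by
    by_contra! hc
    exact hx.2 ⟨hx.1, hc⟩
  obtain ⟨Z, hZ, e, hxe, heU, heg, hes⟩ :=
    exists_straightening (Nat.succ_ne_zero k) hU hg (hA hx.1) hgx
  let φ : Z → V := fun z => e.symm (0, z)
  have hcont : Continuous fun z : Z => ((0 : ℝ), z) := by fun_prop
  have hU' : IsOpen {z : Z | ((0 : ℝ), z) ∈ e.target} := e.open_target.preimage hcont
  have hφ : ContDiffOn ℝ (k + 1 : ℕ) φ {z : Z | ((0 : ℝ), z) ∈ e.target} :=
    hes.comp (by fun_prop) fun z hz => hz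
  obtain ⟨S, hS, hc, hp⟩ := ihd (finrank ℝ Z) (by omega) (k + 1) hU'
    (A := {z : Z | ((0 : ℝ), z) ∈ e.target ∧ φ z ∈ A}) (fun z hz => hz.1) rfl
  refine ⟨e.source, e.open_source.mem_nhds hxe, image φ '' S, hS.image _, ?_, ?_⟩
  · rintro y ⟨hy, hye⟩
    have hy0 : ((0 : ℝ), (e y).2) = e y := by
      rw [← hgA y hy.1, ← heg y hye]
    have hφy : φ (e y).2 = y := by
      simp only [φ, hy0]; exact e.left_inv hye
    obtain ⟨P, hP, hyP⟩ := hc (show (e y).2 ∈ _ from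
      ⟨by rw [hy0]; exact e.map_source hye, by rw [hφy]; exact hy.1⟩)
    exact ⟨φ '' P, mem_image_of_mem _ hP, _, hyP, hφy⟩
  · rintro _ ⟨P, hP, rfl⟩
    exact (hp P hP).image (by omega) (Nat.succ_ne_zero k) hφ
      (fun z hz => heU (e.map_target hz)) fun z hz => hz.2

end FlatCover

/-! ### Null sets of finite-dimensional spaces -/

section Null

open Measure

/-- A subset of a finite-dimensional normed space has Lebesgue measure zero. -/
def IsNull {Y : Type*} [NormedAddCommGroup Y] [NormedSpace ℝ Y] (S : Set Y) : Prop :=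
  letI : MeasurableSpace Y := borel Y
  haveI : BorelSpace Y := ⟨rfl⟩
  μH[finrank ℝ Y] S = 0

variable {Y : Type*} [NormedAddCommGroup Y] [NormedSpace ℝ Y]

theorem isNull_iff_hausdorff [i : MeasurableSpace Y] [BorelSpace Y] {S : Set Y} :
    IsNull S ↔ μH[finrank ℝ Y] S = 0 := by
  have h : i = borel Y := BorelSpace.measurable_eq
  subst h
  rfl

/-- Top-dimensional Hausdorff measure is a Haar measure, and all Haar measures have the same null
sets. -/
theorem isNull_iff [FiniteDimensional ℝ Y] [MeasurableSpace Y] [BorelSpace Y] (μ : Measure Y)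
    [IsAddHaarMeasure μ] {S : Set Y} : IsNull S ↔ μ S = 0 := by
  rw [isNull_iff_hausdorff]
  exact ⟨fun h => absolutelyContinuous_isAddHaarMeasure μ _ h,
    fun h => absolutelyContinuous_isAddHaarMeasure _ μ h⟩

theorem IsNull.mono {S T : Set Y} (h : IsNull T) (hST : S ⊆ T) : IsNull S :=
  measure_mono_null hST h

theorem IsNull.union {S T : Set Y} (hS : IsNull S) (hT : IsNull T) : IsNull (S ∪ T) :=
  measure_union_null hS hT

theorem IsNull.biUnion {ι : Type*} {t : Set ι} (ht : t.Countable) {S : ι → Set Y}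
    (h : ∀ i ∈ t, IsNull (S i)) : IsNull (⋃ i ∈ t, S i) :=
  (measure_biUnion_null_iff ht).2 h

theorem IsNull.image {Z : Type*} [NormedAddCommGroup Z] [NormedSpace ℝ Z] {S : Set Y}
    (h : IsNull S) (L : Y →L[ℝ] Z) (hd : finrank ℝ Y = finrank ℝ Z) : IsNull (L '' S) := by
  borelize Y Z
  rw [isNull_iff_hausdorff] at h ⊢
  have := L.lipschitz.hausdorffMeasure_image_le (d := finrank ℝ Y) (by positivity) S
  rw [h, mul_zero] at this
  rw [← hd]
  exact le_antisymm this zero_le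

theorem isNull_image_iff {Z : Type*} [NormedAddCommGroup Z] [NormedSpace ℝ Z] {S : Set Y}
    (e : Y ≃L[ℝ] Z) : IsNull (e '' S) ↔ IsNull S := by
  have hd := e.toLinearEquiv.finrank_eq
  refine ⟨fun h => ?_, fun h => h.image (e : Y →L[ℝ] Z) hd⟩
  have : IsNull (e.symm '' (e '' S)) := h.image (e.symm : Z →L[ℝ] Y) hd.symm
  rwa [← image_comp, show e.symm ∘ e = id from funext e.symm_apply_apply, image_id] at this

/-- Fubini's theorem for null sets. -/
theorem isNull_prod_of_slices {K C : Type*} [NormedAddCommGroup K] [NormedSpace ℝ K]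
    [FiniteDimensional ℝ K] [NormedAddCommGroup C] [NormedSpace ℝ C] [FiniteDimensional ℝ C]
    {S : Set (K × C)} (hS : IsClosed S) (h : ∀ x, IsNull {y | (x, y) ∈ S}) : IsNull S := by
  borelize K C
  -- Fubini needs `S` measurable, here because it is closed. For this reason the bad sets below are
  -- restricted to compact neighbourhoods before slicing.
  rw [isNull_iff ((μH[finrank ℝ K] : Measure K).prod (μH[finrank ℝ C] : Measure C)),
    measure_prod_null hS.measurableSet]
  exact Eventually.of_forall fun x => isNull_iff_hausdorff.1 (h x)

theorem isNull_image_of_locally {X : Type*} [TopologicalSpace X] [SecondCountableTopology X]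
    {f : X → Set Y} {A : Set X} (h : ∀ x ∈ A, ∃ s ∈ 𝓝 x, IsNull (⋃ z ∈ A ∩ s, f z)) :
    IsNull (⋃ z ∈ A, f z) := by
  have : ∀ x, ∃ s : Set X, (x ∈ A → s ∈ 𝓝 x) ∧ (x ∈ A → IsNull (⋃ z ∈ A ∩ s, f z)) := by
    intro x
    by_cases hx : x ∈ A
    · obtain ⟨s, hs, H⟩ := h x hx
      exact ⟨s, fun _ => hs, fun _ => H⟩
    · exact ⟨∅, fun h => (hx h).elim, fun h => (hx h).elim⟩
  choose s hs hn using this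
  obtain ⟨t, hta, htc, ht⟩ := TopologicalSpace.countable_cover_nhdsWithin
    (f := s) (s := A) fun x hx => mem_nhdsWithin_of_mem_nhds (hs x hx)
  refine (IsNull.biUnion htc fun x hx => hn x (hta hx)).mono ?_
  intro y hy
  obtain ⟨z, hz, hyz⟩ := mem_iUnion₂.1 hy
  obtain ⟨x, hx, hzx⟩ := mem_iUnion₂.1 (ht hz)
  exact mem_iUnion₂.2 ⟨x, hx, mem_iUnion₂.2 ⟨z, ⟨hz, hzx⟩, hyz⟩⟩

/-- Balls of radius `δ / 2` around a dense sequence, made disjoint. On sets this small, flatness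
becomes a Hölder bound. -/
theorem exists_measurable_partition {W : Type*} [NormedAddCommGroup W]
    [TopologicalSpace.SeparableSpace W] [MeasurableSpace W] [BorelSpace W] {δ : ℝ} (hδ : 0 < δ) :
    ∃ T : ℕ → Set W, (∀ i, MeasurableSet (T i)) ∧ Pairwise (Function.onFun Disjoint T) ∧
      (⋃ i, T i) = univ ∧ ∀ i, ∀ x ∈ T i, ∀ y ∈ T i, dist x y < δ := by
  let b : ℕ → Set W := fun i => Metric.ball (TopologicalSpace.denseSeq W i) (δ / 2)
  refine ⟨disjointed b, fun i => MeasurableSet.disjointed (fun _ => measurableSet_ball) i,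
    disjoint_disjointed b, ?_, fun i x hx y hy => ?_⟩
  · rw [iUnion_disjointed]
    refine eq_univ_of_forall fun x => ?_
    obtain ⟨i, hi⟩ := (TopologicalSpace.denseRange_denseSeq W).exists_dist_lt x (half_pos hδ)
    exact mem_iUnion.2 ⟨i, hi⟩
  · have h1 := Metric.mem_ball.1 (disjointed_subset b i hx)
    have h2 := Metric.mem_ball'.1 (disjointed_subset b i hy)
    linarith [dist_triangle x (TopologicalSpace.denseSeq W i) y]

/-- The image of a bounded set under a mapping that is flat of sufficiently high order is null. -/
theorem IsFlat.isNull_image {W : Type*} [NormedAddCommGroup W] [NormedSpace ℝ W]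
    [FiniteDimensional ℝ W] {j : ℕ} (hj : 0 < j) (hY : 0 < finrank ℝ Y)
    (hdim : finrank ℝ W ≤ j * finrank ℝ Y) {B D : Set W} (hB : IsCompact B) (hDB : D ⊆ B)
    {h : W → Y} (hh : IsFlat j D B h) : IsNull (h '' D) := by
  borelize W Y
  rw [isNull_iff_hausdorff]
  have key : ∀ c : NNReal, 0 < c → μH[finrank ℝ Y] (h '' D) ≤
      (c : ENNReal) ^ (finrank ℝ Y : ℝ) * μH[finrank ℝ W] B := by
    intro c hc
    obtain ⟨δ, hδ, H⟩ := hh.exists_forall (NNReal.coe_pos.2 hc)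
    obtain ⟨T, hTm, hTd, hTu, hT⟩ := exists_measurable_partition (W := W) hδ
    have hsub : h '' D ⊆ ⋃ i, h '' (D ∩ T i) := by
      rw [← image_iUnion, ← inter_iUnion, hTu, inter_univ]
    have hpiece : ∀ i, μH[finrank ℝ Y] (h '' (D ∩ T i)) ≤
        (c : ENNReal) ^ (finrank ℝ Y : ℝ) * μH[finrank ℝ W] (B ∩ T i) := by
      intro i
      have hold : HolderOnWith c (j : NNReal) h (D ∩ T i) := by
        intro x hx y hy
        have h1 := H x hx.1 y (hDB hy.1) (hT i x hx.2 y hy.2)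
        rw [edist_nndist, edist_nndist, NNReal.coe_natCast, ENNReal.rpow_natCast]
        norm_cast
        rw [← NNReal.coe_le_coe, coe_nndist, dist_comm, dist_eq_norm]
        simpa using h1
      -- A Hölder mapping of exponent `j` bounds the `d`-dimensional measure of the image by the `j
      -- d`-dimensional measure of the source, which is at most the `dim W`-dimensional one since
      -- `dim W ≤ j d`.
      refine (hold.hausdorffMeasure_image_le (by exact_mod_cast hj)
        (d := finrank ℝ Y) (by positivity)).trans ?_
      refine mul_le_mul' le_rfl ?_
      refine (hausdorffMeasure_mono ?_ _).trans (measure_mono (inter_subset_inter_left _ hDB))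
      exact_mod_cast hdim
    calc μH[finrank ℝ Y] (h '' D) ≤ ∑' i, μH[finrank ℝ Y] (h '' (D ∩ T i)) :=
          (measure_mono hsub).trans (measure_iUnion_le _)
      _ ≤ ∑' i, (c : ENNReal) ^ (finrank ℝ Y : ℝ) * μH[finrank ℝ W] (B ∩ T i) :=
          ENNReal.tsum_le_tsum hpiece
      _ = (c : ENNReal) ^ (finrank ℝ Y : ℝ) * μH[finrank ℝ W] B := by
          rw [ENNReal.tsum_mul_left, ← measure_iUnion
            (fun i k hik => (hTd hik).mono inter_subset_right inter_subset_right)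
            (fun i => hB.measurableSet.inter (hTm i)), ← inter_iUnion, hTu, inter_univ]
  -- As `B` has finite measure and `dim Y > 0`, the bound tends to zero with `c`.
  have hlim : Tendsto (fun c : NNReal =>
      (c : ENNReal) ^ (finrank ℝ Y : ℝ) * μH[finrank ℝ W] B) (𝓝[>] 0) (𝓝 0) := by
    have hY' : (0 : ℝ) < finrank ℝ Y := by exact_mod_cast hY
    have h1 : Tendsto (fun c : NNReal => (c : ENNReal)) (𝓝[>] 0) (𝓝 0) :=
      (ENNReal.continuous_coe.tendsto 0).mono_left nhdsWithin_le_nhds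
    have h2 := (ENNReal.continuous_rpow_const (y := (finrank ℝ Y : ℝ))).tendsto 0
    rw [ENNReal.zero_rpow_of_pos hY'] at h2
    have := ENNReal.Tendsto.mul_const (h2.comp h1) (b := μH[finrank ℝ W] B)
      (Or.inr hB.measure_lt_top.ne)
    rwa [zero_mul] at this
  exact le_antisymm (ge_of_tendsto hlim (eventually_mem_nhdsWithin.mono key)) zero_le

/-- The critical values of rank zero of a `C^(k+1)` mapping `f : X → Y` form a null set if
`dim X ≤ (k + 1) dim Y`. -/
theorem isNull_image_of_fderiv_eq_zero {X : Type*} [NormedAddCommGroup X] [NormedSpace ℝ X]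
    [FiniteDimensional ℝ X] [FiniteDimensional ℝ Y] {k : ℕ} (hY : 0 < finrank ℝ Y)
    (hdim : finrank ℝ X ≤ (k + 1) * finrank ℝ Y) {U S : Set X} (hU : IsOpen U) (hS : S ⊆ U)
    {f : X → Y} (hf : ContDiffOn ℝ (k + 1 : ℕ) f U) (h0 : ∀ x ∈ S, fderiv ℝ f x = 0) :
    IsNull (f '' S) := by
  obtain ⟨T, hT, hST, hP⟩ := hasFlatCover_self k hU hS
  have hsub : f '' S ⊆ ⋃ P ∈ T, f '' P := by
    rintro _ ⟨x, hx, rfl⟩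
    obtain ⟨P, hP, hxP⟩ := hST hx
    exact mem_iUnion₂.2 ⟨P, hP, mem_image_of_mem f hxP⟩
  refine (IsNull.biUnion hT fun P hPT => ?_).mono hsub
  obtain ⟨W, i₁, i₂, i₃, O, B, D, ψ, hfr, hO, hB, hBc, hBO, hDB, hψ, hψU, hPD, hDS, H⟩ := hP P hPT
  refine IsNull.mono ?_ (image_mono hPD)
  rw [← image_comp]
  refine IsFlat.isNull_image (Nat.succ_pos k) hY (hfr.trans hdim) hB hDB
    (IsFlat.of_fderiv hU (hf.differentiableOn (by simp)) hO hB hBc hBO hDB hψ hψU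
    (fun x hx => h0 _ (hDS (mem_image_of_mem ψ hx))) ?_)
  refine isFlat_of_forall_dual fun φ => ?_
  refine H (fun x => φ (fderiv ℝ f x)) ?_ ?_
  · refine φ.contDiff.comp_contDiffOn (hf.fderiv_of_isOpen hU ?_)
    exact_mod_cast le_rfl
  · intro x hx
    simp [h0 x hx]

end Null

/-! ### Sard's theorem -/

section Sard

/-- If `R` is a right inverse of `L₀`, then `L ∘ R` stays invertible for `L` near `L₀`. -/
theorem isOpen_setOf_surjective {X Y : Type*} [NormedAddCommGroup X] [NormedSpace ℝ X]
    [NormedAddCommGroup Y] [NormedSpace ℝ Y] [FiniteDimensional ℝ Y] :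
    IsOpen {L : X →L[ℝ] Y | Function.Surjective L} := by
  have : CompleteSpace Y := FiniteDimensional.complete ℝ Y
  rw [isOpen_iff_mem_nhds]
  intro L₀ hL₀
  obtain ⟨R, hR⟩ := (L₀ : X →ₗ[ℝ] Y).exists_rightInverse_of_surjective
    (LinearMap.range_eq_top.2 hL₀)
  let R' : Y →L[ℝ] X := LinearMap.toContinuousLinearMap R
  have hopen : IsOpen {L : X →L[ℝ] Y | IsUnit (L.comp R')} :=
    Units.isOpen.preimage (f := fun L : X →L[ℝ] Y => L.comp R') (by fun_prop)
  refine mem_of_superset (hopen.mem_nhds ?_) ?_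
  · have : L₀.comp R' = 1 := by
      ext y
      exact LinearMap.congr_fun hR y
    rw [mem_ofPred_eq, this]
    exact isUnit_one
  · rintro L ⟨u, hu⟩ y
    refine ⟨R' ((↑u⁻¹ : Y →L[ℝ] Y) y), ?_⟩
    have h1 : (L.comp R') ((↑u⁻¹ : Y →L[ℝ] Y) y) = ((u * u⁻¹ : (Y →L[ℝ] Y)ˣ) : Y →L[ℝ] Y) y := by
      rw [← hu]; rfl
    rw [mul_inv_cancel] at h1
    exact h1

/-- The mapping is block triangular with the identity as its first diagonal block. -/
theorem surjective_of_fst_of_snd {Z Y : Type*} [AddCommGroup Z] [Module ℝ Z] [AddCommGroup Y]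
    [Module ℝ Y] (N : ℝ × Z →ₗ[ℝ] ℝ × Y) (h₁ : ∀ p, (N p).1 = p.1)
    (h₂ : Function.Surjective fun z => (N (0, z)).2) : Function.Surjective N := by
  rintro ⟨t, y⟩
  obtain ⟨z, hz⟩ := h₂ (y - (N (t, 0)).2)
  refine ⟨(t, z), Prod.ext (h₁ _) ?_⟩
  have : ((t, z) : ℝ × Z) = (t, 0) + (0, z) := by simp
  rw [this, map_add, Prod.snd_add]
  simp only at hz
  rw [hz]
  abel

/-- **Sard's theorem**: the critical values of a `C^k` mapping `f : X → Y` form a null set if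
`k ≥ max (dim X - dim Y + 1, 1)`. -/
theorem isNull_criticalValues {X : Type u} {Y : Type v} [NormedAddCommGroup X] [NormedSpace ℝ X]
    [FiniteDimensional ℝ X] [NormedAddCommGroup Y] [NormedSpace ℝ Y] [FiniteDimensional ℝ Y]
    {k : ℕ} (hk : k ≠ 0) (hdim : finrank ℝ X + 1 ≤ k + finrank ℝ Y) {U : Set X} (hU : IsOpen U)
    {f : X → Y} (hf : ContDiffOn ℝ k f U) :
    IsNull (f '' {x ∈ U | ¬ Function.Surjective (fderiv ℝ f x)}) := by
  induction hb : finrank ℝ Y generalizing X Y with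
  | zero =>
    have := finrank_zero_iff.1 hb
    have : {x ∈ U | ¬ Function.Surjective (fderiv ℝ f x)} = ∅ :=
      eq_empty_of_forall_notMem fun x hx => hx.2 fun y => ⟨0, Subsingleton.elim _ _⟩
    rw [this, image_empty, IsNull]
    exact measure_empty
  | succ b ih =>
  obtain ⟨k, rfl⟩ := Nat.exists_eq_succ_of_ne_zero hk
  have hk' : (((k + 1 : ℕ) : ℕ∞) : WithTop ℕ∞) ≠ 0 := by exact_mod_cast hk
  have hk1 : (1 : WithTop ℕ∞) ≤ ((k + 1 : ℕ) : ℕ∞) := by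
    exact_mod_cast Nat.one_le_iff_ne_zero.2 hk
  have hdc : ContinuousOn (fderiv ℝ f) U := hf.continuousOn_fderiv_of_isOpen hU hk1
  have hdx : ∀ x ∈ U, HasFDerivAt f (fderiv ℝ f x) x := fun x hx =>
    ((hf.contDiffAt (hU.mem_nhds hx)).differentiableAt hk').hasFDerivAt
  have hsplit : {x ∈ U | ¬ Function.Surjective (fderiv ℝ f x)} ⊆
      {x ∈ U | fderiv ℝ f x = 0} ∪
        {x ∈ U | fderiv ℝ f x ≠ 0 ∧ ¬ Function.Surjective (fderiv ℝ f x)} := by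
    intro x hx
    by_cases h : fderiv ℝ f x = 0
    exacts [Or.inl ⟨hx.1, h⟩, Or.inr ⟨hx.1, h, hx.2⟩]
  refine IsNull.mono ?_ (image_mono hsplit)
  rw [image_union]
  -- The smoothness order is now `k + 1`, so `dim X ≤ k + b + 1 ≤ (k + 1) (b + 1)`.
  refine IsNull.union (isNull_image_of_fderiv_eq_zero (by omega) (by rw [hb]; nlinarith) hU
    (fun x hx => hx.1) hf fun x hx => hx.2) ?_
  rw [image_eq_iUnion]
  refine isNull_image_of_locally fun x₀ ⟨hx₀, hne, _⟩ => ?_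
  simp only [← image_eq_iUnion]
  -- straighten one coordinate of `f`
  obtain ⟨φ, hφ⟩ : ∃ φ : Y →L[ℝ] ℝ, φ.comp (fderiv ℝ f x₀) ≠ 0 := by
    obtain ⟨v, hv⟩ := DFunLike.exists_ne hne
    obtain ⟨φ, hφ⟩ := SeparatingDual.exists_ne_zero (R := ℝ) hv
    exact ⟨φ, fun h => hφ (DFunLike.congr_fun h v)⟩
  have hφ0 : φ ≠ 0 := by
    rintro rfl
    exact hφ (ContinuousLinearMap.zero_comp _)
  obtain ⟨w, hw⟩ := exists_apply_eq_one hφ0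
  let Y' := LinearMap.ker (φ : Y →ₗ[ℝ] ℝ)
  let L : Y ≃L[ℝ] ℝ × Y' := (splitByFunctional φ w hw).toContinuousLinearEquiv
  have hL : ∀ y, (L y).1 = φ y := fun y => rfl
  have hY' : finrank ℝ Y' = b := by
    have := L.toLinearEquiv.finrank_eq
    rw [finrank_prod, finrank_self] at this
    omega
  have hg : ContDiffOn ℝ (k + 1 : ℕ) (fun x => φ (f x)) U := φ.contDiff.comp_contDiffOn hf
  obtain ⟨Z, hZ, e, hxe, heU, heg, hes⟩ := exists_straightening hk hU hg hx₀ (by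
    have := (φ.hasFDerivAt.comp x₀ (hdx x₀ hx₀)).fderiv
    exact fun h => hφ (this.symm.trans h))
  obtain ⟨Q, hQ, hxQ, hQe⟩ := exists_compact_subset e.open_source hxe
  have hQU := hQe.trans heU
  refine ⟨Q, mem_interior_iff_mem_nhds.1 hxQ, ?_⟩
  have hcomp : IsCompact (Q ∩ {x | ¬ Function.Surjective (fderiv ℝ f x)}) :=
    hQ.of_isClosed_subset ((hdc.mono hQU).preimage_isClosed_of_isClosed hQ.isClosed
      isOpen_setOf_surjective.isClosed_compl) inter_subset_left
  have hclosed : IsClosed (L '' (f '' (Q ∩ {x | ¬ Function.Surjective (fderiv ℝ f x)}))) :=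
    ((hcomp.image_of_continuousOn
      (hf.continuousOn.mono (inter_subset_left.trans hQU))).image L.continuous).isClosed
  suffices h : IsNull (f '' (Q ∩ {x | ¬ Function.Surjective (fderiv ℝ f x)})) from
    h.mono (image_mono fun x hx => ⟨hx.2, hx.1.2.2⟩)
  rw [← isNull_image_iff L]
  refine isNull_prod_of_slices hclosed fun t => ?_
  -- In the chart `e` the mapping `L ∘ f` preserves the first coordinate `t`, so the slice at `t` of
  -- its critical values consists of critical values of `h`. Both dimensions drop by one, which
  -- preserves the inequality required of `k`.
  let h : Z → Y' := fun z => (L (f (e.symm (t, z)))).2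
  have hV : IsOpen {z : Z | (t, z) ∈ e.target} :=
    e.open_target.preimage (by fun_prop : Continuous fun z : Z => (t, z))
  have hh : ContDiffOn ℝ (k + 1 : ℕ) h {z : Z | (t, z) ∈ e.target} :=
    (contDiff_snd.comp L.contDiff).comp_contDiffOn
      ((hf.comp hes fun p hp => heU (e.map_target hp)).comp
        (by fun_prop : ContDiffOn ℝ (k + 1 : ℕ) (fun z : Z => (t, z)) _) fun z hz => hz)
  refine (ih (X := Z) (Y := Y') (by omega) hV hh hY').mono ?_
  rintro y ⟨_, ⟨x, ⟨hxQ', hns⟩, rfl⟩, hxy⟩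
  have hxs := hQe hxQ'
  have hex : e x = (t, (e x).2) := by
    refine Prod.ext ?_ rfl
    rw [heg x hxs, ← hL, hxy]
  have hinv : e.symm (t, (e x).2) = x := by rw [← hex, e.left_inv hxs]
  have hmem : (t, (e x).2) ∈ e.target := by rw [← hex]; exact e.map_source hxs
  refine ⟨(e x).2, ⟨hmem, fun hs => hns ?_⟩, by simp only [h]; rw [hinv, hxy]⟩
  have hde : HasFDerivAt e.symm (fderiv ℝ e.symm (t, (e x).2)) (t, (e x).2) :=
    ((hes.contDiffAt (e.open_target.mem_nhds hmem)).differentiableAt hk').hasFDerivAt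
  have hdf : HasFDerivAt f (fderiv ℝ f x) (e.symm (t, (e x).2)) := by
    rw [hinv]; exact hdx x (hQU hxQ')
  let N : ℝ × Z →L[ℝ] ℝ × Y' :=
    (L : Y →L[ℝ] ℝ × Y').comp ((fderiv ℝ f x).comp (fderiv ℝ e.symm (t, (e x).2)))
  have hN : HasFDerivAt (fun p => L (f (e.symm p))) N (t, (e x).2) :=
    L.hasFDerivAt.comp _ (hdf.comp _ hde)
  have hN₁ : ∀ p, (N p).1 = p.1 := by
    have h1 : HasFDerivAt (fun p => (L (f (e.symm p))).1)
        ((ContinuousLinearMap.fst ℝ ℝ Y').comp N) (t, (e x).2) :=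
      (ContinuousLinearMap.fst ℝ ℝ Y').hasFDerivAt.comp _ hN
    have h2 : HasFDerivAt (fun p => (L (f (e.symm p))).1)
        (ContinuousLinearMap.fst ℝ ℝ Z) (t, (e x).2) := by
      refine (ContinuousLinearMap.fst ℝ ℝ Z).hasFDerivAt.congr_of_eventuallyEq ?_
      filter_upwards [e.open_target.mem_nhds hmem] with p hp
      rw [hL, ← heg _ (e.map_target hp), e.right_inv hp]
      rfl
    exact fun p => DFunLike.congr_fun (h1.unique h2) p
  have hN₂ : fderiv ℝ h (e x).2 = (ContinuousLinearMap.snd ℝ ℝ Y').comp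
      (N.comp (ContinuousLinearMap.inr ℝ ℝ Z)) :=
    ((ContinuousLinearMap.snd ℝ ℝ Y').hasFDerivAt.comp _
      (hN.comp _ (hasFDerivAt_prodMk_right t (e x).2))).fderiv
  rw [hN₂] at hs
  have hsurj : Function.Surjective N := surjective_of_fst_of_snd (N : ℝ × Z →ₗ[ℝ] ℝ × Y') hN₁ hs
  intro y'
  obtain ⟨p, hp⟩ := hsurj (L y')
  exact ⟨_, L.injective hp⟩

end Sard

/-! ### Parametric transversality -/

section Parametric

/-- Let `A x : P → Y` be surjective linear mappings. For almost all `π`, zero is a regular value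
of `x ↦ G x + A x π`. -/
theorem isNull_setOf_exists_critical_zero {X : Type u} {Y : Type v} {P : Type w}
    [NormedAddCommGroup X] [NormedSpace ℝ X] [FiniteDimensional ℝ X] [NormedAddCommGroup Y]
    [NormedSpace ℝ Y] [FiniteDimensional ℝ Y] [NormedAddCommGroup P] [NormedSpace ℝ P]
    [FiniteDimensional ℝ P] {k : ℕ} (hk : k ≠ 0) (hdim : finrank ℝ X + 1 ≤ k + finrank ℝ Y)
    {O : Set X} (hO : IsOpen O) {G : X → Y} {A : X → P →L[ℝ] Y} (hG : ContDiffOn ℝ k G O)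
    (hA : ContDiffOn ℝ k A O) (hsurj : ∀ x ∈ O, Function.Surjective (A x)) :
    IsNull {π | ∃ x ∈ O, G x + A x π = 0 ∧
      ¬ Function.Surjective (fderiv ℝ (fun x => G x + A x π) x)} := by
  have hk' : ((k : ℕ∞) : WithTop ℕ∞) ≠ 0 := by exact_mod_cast hk
  have hk1 : (1 : WithTop ℕ∞) ≤ k := by exact_mod_cast Nat.one_le_iff_ne_zero.2 hk
  have hset : {π | ∃ x ∈ O, G x + A x π = 0 ∧
      ¬ Function.Surjective (fderiv ℝ (fun x => G x + A x π) x)} = ⋃ x ∈ O, {π | G x + A x π = 0 ∧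
      ¬ Function.Surjective (fderiv ℝ (fun x => G x + A x π) x)} := by
    ext π; simp only [mem_iUnion₂, mem_ofPred_eq, exists_prop]
  rw [hset]
  refine isNull_image_of_locally fun x₀ hx₀ => ?_
  let D : X → P → X →L[ℝ] Y := fun x π => fderiv ℝ G x + (fderiv ℝ A x).flip π
  have hD : ∀ x ∈ O, ∀ π, HasFDerivAt (fun x => G x + A x π) (D x π) x := by
    intro x hx π
    have h1 := ((hG.contDiffAt (hO.mem_nhds hx)).differentiableAt hk').hasFDerivAt
    have h2 := ((hA.contDiffAt (hO.mem_nhds hx)).differentiableAt hk').hasFDerivAt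
    convert! h1.add (h2.clm_apply (hasFDerivAt_const π x)) using 1
    ext v
    simp [D]
  -- a complement of the kernel
  obtain ⟨C, hC⟩ := (LinearMap.ker (A x₀ : P →ₗ[ℝ] Y)).exists_isCompl
  let K := LinearMap.ker (A x₀ : P →ₗ[ℝ] Y)
  let e : (K × C) ≃L[ℝ] P := (Submodule.prodEquivOfIsCompl K C hC).toContinuousLinearEquiv
  have he : ∀ p : K × C, e p = p.1 + p.2 := fun p => rfl
  let Ac : X → C →L[ℝ] Y := fun x => (A x).comp C.subtypeL
  have hAc : ContDiffOn ℝ k Ac O := hA.clm_comp contDiffOn_const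
  have hbij : Function.Bijective (Ac x₀) := by
    constructor
    · rw [injective_iff_map_eq_zero]
      intro c hc
      have : (c : P) ∈ K ⊓ C := ⟨hc, c.2⟩
      rw [hC.inf_eq_bot] at this
      exact Subtype.ext this
    · intro y
      obtain ⟨π, rfl⟩ := hsurj x₀ hx₀ y
      refine ⟨(e.symm π).2, ?_⟩
      have h1 : π = (e.symm π).1 + (e.symm π).2 := by rw [← he, e.apply_symm_apply]
      have h2 : A x₀ ((e.symm π).1 : P) = 0 := (e.symm π).1.2
      conv_rhs => rw [h1, map_add, h2, zero_add]
      rfl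
  let E₀ : C ≃L[ℝ] Y :=
    (LinearEquiv.ofBijective (Ac x₀ : C →ₗ[ℝ] Y) hbij).toContinuousLinearEquiv
  have hO₁ : IsOpen (O ∩ Ac ⁻¹' range ((↑) : (C ≃L[ℝ] Y) → C →L[ℝ] Y)) :=
    hAc.continuousOn.isOpen_inter_preimage hO ContinuousLinearEquiv.isOpen
  set O₁ := O ∩ Ac ⁻¹' range ((↑) : (C ≃L[ℝ] Y) → C →L[ℝ] Y)
  have hx₁ : x₀ ∈ O₁ := ⟨hx₀, E₀, rfl⟩
  have hO₁O : O₁ ⊆ O := inter_subset_left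
  obtain ⟨Q, hQ, hxQ, hQO⟩ := exists_compact_subset hO₁ hx₁
  refine ⟨Q, mem_interior_iff_mem_nhds.1 hxQ, ?_⟩
  -- the bad set over the compact neighbourhood `Q` is closed
  let S : Set P := {π | ∃ x ∈ Q, G x + A x π = 0 ∧ ¬ Function.Surjective (D x π)}
  have hS : IsClosed S := by
    have : CompactSpace Q := isCompact_iff_compactSpace.1 hQ
    have hQO' : Q ⊆ O := hQO.trans hO₁O
    have cG : Continuous fun x : Q => G x :=
      continuousOn_iff_continuous_domRestrict.1 (hG.continuousOn.mono hQO')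
    have cA : Continuous fun x : Q => A x :=
      continuousOn_iff_continuous_domRestrict.1 (hA.continuousOn.mono hQO')
    have cG' : Continuous fun x : Q => fderiv ℝ G x :=
      continuousOn_iff_continuous_domRestrict.1
        ((hG.continuousOn_fderiv_of_isOpen hO hk1).mono hQO')
    have cA' : Continuous fun x : Q => fderiv ℝ A x :=
      continuousOn_iff_continuous_domRestrict.1
        ((hA.continuousOn_fderiv_of_isOpen hO hk1).mono hQO')
    have cflip : Continuous fun x : Q => (fderiv ℝ A x).flip :=
      (ContinuousLinearMap.flipₗᵢ ℝ X P Y).continuous.comp cA'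
    have h1 : IsClosed {p : Q × P | G p.1 + A p.1 p.2 = 0} :=
      isClosed_eq ((cG.comp continuous_fst).add
        ((cA.comp continuous_fst).clm_apply continuous_snd)) continuous_const
    have h2 : IsClosed {p : Q × P | ¬ Function.Surjective (D p.1 p.2)} := by
      have : Continuous fun p : Q × P => D p.1 p.2 :=
        (cG'.comp continuous_fst).add ((cflip.comp continuous_fst).clm_apply continuous_snd)
      exact (isOpen_setOf_surjective.preimage this).isClosed_compl
    have h3 := isClosedMap_snd_of_compactSpace _ (h1.inter h2)
    convert! h3 using 1
    ext π
    constructor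
    · rintro ⟨x, hx, h⟩
      exact ⟨(⟨x, hx⟩, π), h, rfl⟩
    · rintro ⟨⟨x, π'⟩, h, rfl⟩
      exact ⟨x, x.2, h⟩
  suffices hSn : IsNull S by
    refine hSn.mono ?_
    intro π hπ
    obtain ⟨x, hx, h, h'⟩ := mem_iUnion₂.1 hπ
    exact ⟨x, hx.2, h, by rwa [(hD x hx.1 π).fderiv] at h'⟩
  rw [← image_preimage_eq S e.surjective, isNull_image_iff e]
  refine isNull_prod_of_slices (hS.preimage e.continuous) fun κ => ?_
  -- For fixed `κ`, `c = h x` is the only solution of `G x + A x (κ + c) = 0` in `C`. The slice at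
  -- `κ` is thus made of values of `h`, and `dim C = dim Y`.
  let h : X → C := fun x => -(Ac x).inverse (G x + A x κ)
  have hh : ContDiffOn ℝ k h O₁ := by
    intro x hx
    obtain ⟨L, hL⟩ := hx.2
    have h1 : ContDiffAt ℝ k (fun x => (Ac x).inverse) x := by
      refine ContDiffAt.comp x (g := ContinuousLinearMap.inverse) ?_
        (hAc.contDiffAt (hO.mem_nhds hx.1))
      rw [← hL]
      exact contDiffAt_map_inverse L
    exact (h1.clm_apply ((hG.contDiffAt (hO.mem_nhds hx.1)).add
      ((hA.contDiffAt (hO.mem_nhds hx.1)).clm_apply contDiffAt_const))).neg.contDiffWithinAt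
  have hid : ∀ x ∈ O₁, G x + A x κ + Ac x (h x) = 0 := by
    rintro x ⟨_, L, hL⟩
    simp only [h]
    rw [← hL, ContinuousLinearMap.inverse_equiv]
    simp
  have hinj : ∀ x ∈ O₁, Function.Injective (Ac x) := by
    rintro x ⟨_, L, hL⟩
    rw [← hL]
    exact L.injective
  have hsC : ∀ x ∈ O₁, Function.Surjective (Ac x) := by
    rintro x ⟨_, L, hL⟩
    rw [← hL]
    exact L.surjective
  have hfr : finrank ℝ C = finrank ℝ Y := E₀.toLinearEquiv.finrank_eq
  refine (isNull_criticalValues hk (hfr ▸ hdim) hO₁ hh).mono ?_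
  rintro c ⟨x, hxQ', hzero, hns⟩
  have hx := hQO hxQ'
  have hc : h x = c := by
    refine hinj x hx ?_
    have h1 := hid x hx
    rw [he, map_add, ← add_assoc] at hzero
    have h2 : A x (c : P) = Ac x c := rfl
    rw [h2] at hzero
    exact add_left_cancel (h1.trans hzero.symm)
  refine ⟨x, ⟨hx, fun hs => hns ?_⟩, hc⟩
  -- Differentiating the identity `hid` gives `D x (κ + c) = -(Ac x) ∘ h'(x)`. As `Ac x` is
  -- invertible, a critical zero of the family is a critical point of `h`.
  have hder : HasFDerivAt (fun x => G x + A x κ + Ac x (h x))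
      (D x κ + ((Ac x).comp (fderiv ℝ h x) + (fderiv ℝ Ac x).flip (h x))) x := by
    have h1 := ((hAc.contDiffAt (hO.mem_nhds hx.1)).differentiableAt hk').hasFDerivAt
    have h2 := ((hh.contDiffAt (hO₁.mem_nhds hx)).differentiableAt hk').hasFDerivAt
    exact (hD x hx.1 κ).add (h1.clm_apply h2)
  have hzd : HasFDerivAt (fun x => G x + A x κ + Ac x (h x)) (0 : X →L[ℝ] Y) x := by
    refine (hasFDerivAt_const (0 : Y) x).congr_of_eventuallyEq ?_
    filter_upwards [hO₁.mem_nhds hx] with z hz using hid z hz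
  have heq := hder.unique hzd
  have hAcd : ∀ v, fderiv ℝ Ac x v = (fderiv ℝ A x v).comp C.subtypeL := by
    intro v
    have h2 := ((hA.contDiffAt (hO.mem_nhds hx.1)).differentiableAt hk').hasFDerivAt
    have h3 := h2.clm_comp (hasFDerivAt_const C.subtypeL x)
    rw [h3.fderiv]
    simp
  have hDv : ∀ v, D x (e (κ, c)) v = -Ac x (fderiv ℝ h x v) := by
    intro v
    have h1 := DFunLike.congr_fun heq v
    simp only [D, he, map_add, add_apply, ContinuousLinearMap.flip_apply,
      ContinuousLinearMap.comp_apply, hAcd, hc, zero_apply,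
      Submodule.subtypeL_apply] at h1 ⊢
    rw [eq_neg_iff_add_eq_zero, ← h1]
    abel
  intro y
  obtain ⟨c', hc'⟩ := hsC x hx (-y)
  obtain ⟨v, rfl⟩ := hs c'
  exact ⟨v, by rw [hDv, hc', neg_neg]⟩

end Parametric

/-! ### Finite products of manifolds -/

section Pi

variable {ι : Type*} [Fintype ι] {B : ι → Type*} [∀ i, NormedAddCommGroup (B i)]
  [∀ i, NormedSpace ℝ (B i)] {H : ι → Type*} [∀ i, TopologicalSpace (H i)]
  (I : ∀ i, ModelWithCorners ℝ (B i) (H i)) (M : ι → Type*) [∀ i, TopologicalSpace (M i)]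
  [∀ i, ChartedSpace (H i) (M i)]

instance boundaryless_pi [∀ i, (I i).Boundaryless] : (ModelWithCorners.pi I).Boundaryless where
  range_eq_univ := by
    have : range (fun (x : ∀ i, H i) i => I i (x i)) = univ := by
      refine range_eq_univ.2 fun y => ?_
      have h : ∀ i, ∃ x, I i x = y i := fun i => by
        have := (I i).range_eq_univ
        exact range_eq_univ.1 this (y i)
      choose x hx using h
      exact ⟨x, funext hx⟩
    exact this

instance isManifold_pi {k : WithTop ℕ∞} [∀ i, IsManifold (I i) k (M i)] :
    IsManifold (ModelWithCorners.pi I) k (∀ i, M i) := by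
  refine isManifold_of_contDiffOn _ _ _ ?_
  rintro _ _ ⟨e, he, rfl⟩ ⟨e', he', rfl⟩
  refine contDiffOn_pi.2 fun i => ?_
  have h1 : (e i).symm ≫ₕ e' i ∈ contDiffGroupoid k (I i) :=
    (contDiffGroupoid k (I i)).compatible (he i trivial) (he' i trivial)
  rw [contDiffGroupoid, mem_groupoid_of_pregroupoid] at h1
  refine h1.1.comp (s := (ModelWithCorners.pi I).symm ⁻¹'
    ((OpenPartialHomeomorph.pi e).symm ≫ₕ OpenPartialHomeomorph.pi e').source ∩
      range (ModelWithCorners.pi I))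
    (ContinuousLinearMap.proj (R := ℝ) (φ := B) i).contDiff.contDiffOn ?_
  rintro x ⟨hx, y, rfl⟩
  exact ⟨⟨hx.1 i trivial, hx.2 i trivial⟩, mem_range_self _⟩

theorem contMDiff_eval {k : WithTop ℕ∞} (i : ι) :
    ContMDiff (ModelWithCorners.pi I) (I i) k fun x : ∀ i, M i => x i := by
  intro x
  rw [contMDiffAt_iff]
  refine ⟨(continuous_apply i).continuousAt, ?_⟩
  have hproj := (ContinuousLinearMap.proj (R := ℝ) (φ := B) i).contDiff (n := k)
  refine hproj.contDiffWithinAt.congr_of_eventuallyEq ?_ ?_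
  · filter_upwards [extChartAt_target_mem_nhdsWithin (I := ModelWithCorners.pi I) x] with y hy
    rw [extChartAt_target] at hy
    exact (extChartAt (I i) (x i)).right_inv (by
      rw [extChartAt_target]
      obtain ⟨hy, z, rfl⟩ := hy
      exact ⟨hy i trivial, mem_range_self _⟩)
  · exact congrArg (extChartAt (I i) (x i)) ((extChartAt (I i) (x i)).left_inv
      (mem_extChartAt_source (x i)))

end Pi

section Manifold

variable {B : Type u} [NormedAddCommGroup B] [NormedSpace ℝ B] [FiniteDimensional ℝ B]
  {H : Type*} [TopologicalSpace H] {I : ModelWithCorners ℝ B H} [I.Boundaryless]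
  {M : Type*} [TopologicalSpace M] [SecondCountableTopology M] [ChartedSpace H M]
  {Y : Type v} [NormedAddCommGroup Y] [NormedSpace ℝ Y] [FiniteDimensional ℝ Y]
  {P : Type w} [NormedAddCommGroup P] [NormedSpace ℝ P] [FiniteDimensional ℝ P]

/-- Parametric transversality for families `q ↦ G q + A q π` on a manifold. -/
theorem isNull_setOf_exists_mfderiv_critical_zero {k : ℕ} [IsManifold I k M] (hk : k ≠ 0)
    (hdim : finrank ℝ B + 1 ≤ k + finrank ℝ Y) {G : M → Y} {A : M → P →L[ℝ] Y}
    (hG : ContMDiff I 𝓘(ℝ, Y) k G) (hA : ContMDiff I 𝓘(ℝ, P →L[ℝ] Y) k A)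
    (hsurj : ∀ q, Function.Surjective (A q)) :
    IsNull {π | ∃ q, G q + A q π = 0 ∧
      ¬ Function.Surjective (mfderiv I 𝓘(ℝ, Y) (fun q => G q + A q π) q)} := by
  have hk' : ((k : ℕ∞) : WithTop ℕ∞) ≠ 0 := by exact_mod_cast hk
  have hset : {π | ∃ q, G q + A q π = 0 ∧
      ¬ Function.Surjective (mfderiv I 𝓘(ℝ, Y) (fun q => G q + A q π) q)} =
      ⋃ q ∈ (univ : Set M), {π | G q + A q π = 0 ∧
      ¬ Function.Surjective (mfderiv I 𝓘(ℝ, Y) (fun q => G q + A q π) q)} := by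
    ext π; simp only [mem_iUnion₂, mem_ofPred_eq, exists_prop, mem_univ, true_and]
  rw [hset]
  refine isNull_image_of_locally fun q₀ _ => ⟨_, extChartAt_source_mem_nhds (I := I) q₀, ?_⟩
  set Φ := extChartAt I q₀
  have hΦ : ContMDiffOn 𝓘(ℝ, B) I k Φ.symm Φ.target := contMDiffOn_extChartAt_symm q₀
  have hO : IsOpen Φ.target := isOpen_extChartAt_target q₀
  refine (isNull_setOf_exists_critical_zero hk hdim hO (G := G ∘ Φ.symm) (A := A ∘ Φ.symm)
    (contMDiffOn_iff_contDiffOn.1 (hG.comp_contMDiffOn hΦ))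
    (contMDiffOn_iff_contDiffOn.1 (hA.comp_contMDiffOn hΦ)) fun x _ => hsurj _).mono ?_
  intro π hπ
  obtain ⟨q, hq, h0, hns⟩ := mem_iUnion₂.1 hπ
  have hq' := hq.2
  refine ⟨Φ q, Φ.map_source hq', by simpa only [Function.comp, Φ.left_inv hq'] using h0,
    fun hs => hns ?_⟩
  have hd : MDifferentiableAt I 𝓘(ℝ, Y) (fun q => G q + A q π) (Φ.symm (Φ q)) := by
    have h1 : ContMDiff I 𝓘(ℝ, Y) k fun q => G q + A q π :=
      hG.add (hA.clm_apply contMDiff_const)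
    exact h1.mdifferentiableAt hk'
  have hdΦ : MDifferentiableAt 𝓘(ℝ, B) I Φ.symm (Φ q) :=
    (hΦ.contMDiffAt (hO.mem_nhds (Φ.map_source hq'))).mdifferentiableAt hk'
  have hc := mfderiv_comp (Φ q) hd hdΦ
  rw [mfderiv_eq_fderiv, Φ.left_inv hq'] at hc
  intro y
  obtain ⟨v, hv⟩ := hs y
  refine ⟨mfderiv 𝓘(ℝ, B) I Φ.symm (Φ q) v, ?_⟩
  rw [← hv]
  exact (DFunLike.congr_fun hc v).symm

end Manifold

/-! ### General position -/

section GeneralPosition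

theorem infinite_of_chartedSpace {n : ℕ} (hn : 0 < n) (N : Type*) [TopologicalSpace N] [Nonempty N]
    [ChartedSpace (E n) N] : Infinite N := by
  obtain ⟨q⟩ := ‹Nonempty N›
  have : Nonempty (Fin n) := ⟨⟨0, hn⟩⟩
  let e := chartAt (E n) q
  have h1 : e.target.Infinite :=
    infinite_of_mem_nhds (e q) (e.open_target.mem_nhds (e.map_source (mem_chart_source _ q)))
  exact infinite_coe_iff.1 ((h1.image e.symm.injOn).to_subtype) |>.to_subtype.of_injective _
    Subtype.val_injective

variable {N : Type*} {m : ℕ}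

/-- The vectors `f (q i) - f (q 0)` are linearly independent for all distinct `q 0, …, q t`. -/
def InGeneralPosition (f : N → E m) (t : ℕ) : Prop :=
  ∀ q : Fin (t + 1) → N, Function.Injective q →
    LinearIndependent ℝ fun i : Fin t => f (q i.succ) - f (q 0)

/-- The tuple is extended by a further distinct point, available because `N` is infinite; a
subfamily of an independent family is independent. -/
theorem InGeneralPosition.of_succ [Infinite N] {f : N → E m} {t : ℕ}
    (h : InGeneralPosition f (t + 1)) : InGeneralPosition f t := by
  intro q hq
  obtain ⟨x, hx⟩ := Set.Finite.exists_notMem (finite_range q)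
  have h1 := h (Fin.snoc q x : Fin (t + 1 + 1) → N) (Fin.snoc_injective_iff.2 ⟨hq, hx⟩)
  convert h1.comp Fin.castSucc (Fin.castSucc_injective t) using 1
  have h0 : (Fin.snoc q x : Fin (t + 1 + 1) → N) 0 = q 0 :=
    Fin.snoc_castSucc (α := fun _ => N) x q 0
  ext1 i
  simp only [Function.comp, Fin.succ_castSucc, Fin.snoc_castSucc, h0]

theorem InGeneralPosition.of_le [Infinite N] {f : N → E m} {t t' : ℕ} (htt' : t ≤ t')
    (h : InGeneralPosition f t') : InGeneralPosition f t := by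
  induction t', htt' using Nat.le_induction with
  | base => exact h
  | succ _ _ ih => exact ih h.of_succ

theorem inGeneralPosition_of_mem {f : N → E m} {t : ℕ} (h : t + 1 ∈ generalPositionSet f) :
    InGeneralPosition f t := by
  obtain ⟨hs, H⟩ := h
  intro q hq
  rw [linearIndependent_iff_card_eq_finrank_span, Fintype.card_fin, Set.finrank]
  have h1 := H q fun i j hij h => hij (hq h)
  have h0 : (⟨0, hs⟩ : Fin (t + 1)) = 0 := rfl
  rw [h0, Nat.add_sub_cancel] at h1
  refine h1.symm.trans ?_
  suffices hset : (fun i : Fin (t + 1) => f (q i) - f (q 0)) '' {i | i ≠ 0} =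
      range fun i : Fin t => f (q i.succ) - f (q 0) by rw [hset]
  ext v
  constructor
  · rintro ⟨i, hi, rfl⟩
    obtain ⟨j, rfl⟩ := Fin.exists_succ_eq.2 hi
    exact ⟨j, rfl⟩
  · rintro ⟨j, rfl⟩
    exact ⟨j.succ, Fin.succ_ne_zero j, rfl⟩

theorem inGeneralPosition_of_lt_sMax [Infinite N] {f : N → E m} {t : ℕ} (ht : t < sMax f) :
    InGeneralPosition f t := by
  obtain ⟨t', ht'⟩ := Nat.exists_eq_add_of_lt ht
  refine InGeneralPosition.of_le (t' := t + t') (by omega) (inGeneralPosition_of_mem ?_)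
  rw [← ht']
  exact (isGreatest_sMax f).1.1

end GeneralPosition

/-! ### Evaluation of linear mappings and differences -/

section Evaluation

variable {l m t : ℕ}

/-- The mapping `b ↦ (π ↦ (π b_1, …, π b_t))`. -/
def evalTuple (l m t : ℕ) : (Fin t → E m) →L[ℝ] (E m →L[ℝ] E l) →L[ℝ] (Fin t → E l) :=
  LinearMap.toContinuousLinearMap
    { toFun := fun b => ContinuousLinearMap.pi fun i => ContinuousLinearMap.apply ℝ (E l) (b i)
      map_add' := fun b b' => by ext; simp
      map_smul' := fun c b => by ext; simp }

@[simp]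
theorem evalTuple_apply (b : Fin t → E m) (π : E m →L[ℝ] E l) (i : Fin t) :
    evalTuple l m t b π i = π (b i) := rfl

/-- A linear mapping can be prescribed on independent vectors. -/
theorem surjective_evalTuple {b : Fin t → E m} (hb : LinearIndependent ℝ b) :
    Function.Surjective (evalTuple l m t b) := by
  intro y
  obtain ⟨g, hg⟩ := (Finsupp.linearCombination ℝ b).exists_leftInverse_of_injective
    (LinearMap.ker_eq_bot.2 hb)
  refine ⟨LinearMap.toContinuousLinearMap ((Finsupp.linearCombination ℝ y).comp g), ?_⟩
  funext i
  have h1 : g (b i) = Finsupp.single i 1 := by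
    have := LinearMap.congr_fun hg (Finsupp.single i 1)
    simpa using this
  simp [h1]

/-- The differences `(z_1 - z_0, …, z_t - z_0)`. -/
def differences (l t : ℕ) : (Fin (t + 1) → E l) →L[ℝ] (Fin t → E l) :=
  ContinuousLinearMap.pi fun i =>
    ContinuousLinearMap.proj (R := ℝ) (φ := fun _ => E l) i.succ - ContinuousLinearMap.proj 0

@[simp]
theorem differences_apply (z : Fin (t + 1) → E l) (i : Fin t) :
    differences l t z i = z i.succ - z 0 := rfl

theorem differences_eq_zero_iff {z : Fin (t + 1) → E l} :
    differences l t z = 0 ↔ z ∈ diagonal l (t + 1) := by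
  constructor
  · intro h
    refine ⟨z 0, funext fun i => ?_⟩
    refine Fin.cases rfl (fun j => ?_) i
    exact sub_eq_zero.1 (congrFun h j)
  · rintro ⟨y, rfl⟩
    funext i
    simp

theorem mem_tangentSpaceOf {V : Type*} [NormedAddCommGroup V] [NormedSpace ℝ V] {Z : Set V}
    {z v : V} {γ : ℝ → V} (hγ : ContDiff ℝ 1 γ) (hZ : ∀ τ, γ τ ∈ Z) (hz : γ 0 = z)
    (hv : deriv γ 0 = v) : v ∈ tangentSpaceOf Z z :=
  Submodule.subset_span ⟨γ, hγ, hZ, hz, hv⟩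

/-- A vector of the kernel is a constant tuple, hence the velocity of a straight line inside the
diagonal. -/
theorem ker_differences_le_tangentSpaceOf {z : Fin (t + 1) → E l}
    (hz : z ∈ diagonal l (t + 1)) :
    LinearMap.ker (differences l t : (Fin (t + 1) → E l) →ₗ[ℝ] (Fin t → E l)) ≤
      tangentSpaceOf (diagonal l (t + 1)) z := by
  intro v hv
  obtain ⟨y, rfl⟩ := hz
  obtain ⟨w, rfl⟩ := differences_eq_zero_iff.1 hv
  let v : Fin (t + 1) → E l := fun _ => w
  let z : Fin (t + 1) → E l := fun _ => y
  have h : HasDerivAt (fun τ : ℝ => z + τ • v) v 0 := hasDerivAt_pi.2 fun i => by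
    have h := ((hasDerivAt_id (0 : ℝ)).smul_const w).const_add y
    rwa [one_smul] at h
  exact mem_tangentSpaceOf (γ := fun τ => z + τ • v) (by fun_prop)
    (fun τ => ⟨y + τ • w, rfl⟩) (by simp [z]) h.deriv

end Evaluation

/-! ### Generic linear perturbations -/

section Perturbation

variable {n m l : ℕ} {N : Type*} [TopologicalSpace N] [T2Space N] [ChartedSpace (E n) N]

theorem contMDiff_clm_apply {B H M V W : Type*} [NormedAddCommGroup B] [NormedSpace ℝ B]
    [TopologicalSpace H] {I : ModelWithCorners ℝ B H} [TopologicalSpace M] [ChartedSpace H M]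
    [NormedAddCommGroup V] [NormedSpace ℝ V] [NormedAddCommGroup W] [NormedSpace ℝ W]
    {k : WithTop ℕ∞} (L : V →L[ℝ] W) {b : M → V} (hb : ContMDiff I 𝓘(ℝ, V) k b) :
    ContMDiff I 𝓘(ℝ, W) k fun q => L (b q) :=
  L.contMDiff.comp hb

theorem contMDiff_coord (k : WithTop ℕ∞) (s : ℕ) (i : Fin s) :
    ContMDiff (powModel n s) (𝓡 n) k fun q : distinctTuples N s => q.1 i :=
  (contMDiff_eval (fun _ : Fin s => 𝓡 n) (fun _ => N) i).comp contMDiff_subtype_val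

theorem contMDiff_multiMap {k : WithTop ℕ∞} {g : N → E l} (hg : ContMDiff (𝓡 n) 𝓘(ℝ, E l) k g)
    (s : ℕ) : ContMDiff (powModel n s) 𝓘(ℝ, Fin s → E l) k (multiMap g s) :=
  contMDiff_pi_space.2 fun i => hg.comp (contMDiff_coord k s i)

/-- Transversality to the diagonal follows from the regularity of the differences. -/
theorem isTransverse_diagonal {g : N → E l} {t : ℕ}
    (hg : MDifferentiable (powModel n (t + 1)) 𝓘(ℝ, Fin (t + 1) → E l) (multiMap g (t + 1)))
    (h : ∀ q, differences l t (multiMap g (t + 1) q) = 0 →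
      Function.Surjective (mfderiv (powModel n (t + 1)) 𝓘(ℝ, Fin t → E l)
        (fun q => differences l t (multiMap g (t + 1) q)) q)) :
    IsTransverse (powModel n (t + 1)) (multiMap g (t + 1)) (diagonal l (t + 1)) := by
  intro q hq
  have hs := h q (differences_eq_zero_iff.2 hq)
  have hc := mfderiv_comp q
    ((differences l t).mdifferentiableAt (x := multiMap g (t + 1) q)) (hg q)
  rw [ContinuousLinearMap.mfderiv_eq] at hc
  rw [eq_top_iff]
  intro v _
  -- The image of `w` has the same differences as `v`, so the remainder is tangent to the diagonal.
  obtain ⟨w, hw⟩ := hs (differences l t v)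
  have hw' : differences l t (mfderiv (powModel n (t + 1)) 𝓘(ℝ, Fin (t + 1) → E l)
      (multiMap g (t + 1)) q w) = differences l t v :=
    (DFunLike.congr_fun hc w).symm.trans hw
  refine Submodule.mem_sup.2 ⟨_, LinearMap.mem_range_self _ w, v - _,
    ker_differences_le_tangentSpaceOf hq ?_, add_sub_cancel _ v⟩
  exact (map_sub (differences l t) (v : Fin (t + 1) → E l) _).trans (sub_eq_zero.2 hw'.symm)

/-- For almost all linear mappings `π`, the multi-map of `g₀ + π ∘ f` is transverse to the
diagonal, provided that `f` is in general position. -/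
theorem isNull_setOf_not_isTransverse [SecondCountableTopology N] {k : ℕ} [IsManifold (𝓡 n) k N]
    (hk : k ≠ 0) {t : ℕ} (hdim : (t + 1) * n + 1 ≤ k + t * l) {f : N → E m}
    (hf : ContMDiff (𝓡 n) 𝓘(ℝ, E m) k f) {g₀ : N → E l}
    (hg₀ : ContMDiff (𝓡 n) 𝓘(ℝ, E l) k g₀) (hpos : InGeneralPosition f t) :
    IsNull {π : E m →L[ℝ] E l | ¬ IsTransverse (powModel n (t + 1))
      (multiMap (fun q => g₀ q + π (f q)) (t + 1)) (diagonal l (t + 1))} := by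
  have hk' : ((k : ℕ∞) : WithTop ℕ∞) ≠ 0 := by exact_mod_cast hk
  let b : distinctTuples N (t + 1) → Fin t → E m := fun q i => f (q.1 i.succ) - f (q.1 0)
  have hb : ContMDiff (powModel n (t + 1)) 𝓘(ℝ, Fin t → E m) k b :=
    contMDiff_pi_space.2 fun i =>
      (hf.comp (contMDiff_coord k _ i.succ)).sub (hf.comp (contMDiff_coord k _ 0))
  have hG : ContMDiff (powModel n (t + 1)) 𝓘(ℝ, Fin t → E l) k
      fun q => differences l t (multiMap g₀ (t + 1) q) :=
    contMDiff_clm_apply (V := Fin (t + 1) → E l) (W := Fin t → E l) (differences l t)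
      (contMDiff_multiMap hg₀ _)
  have hA : ContMDiff (powModel n (t + 1)) 𝓘(ℝ, (E m →L[ℝ] E l) →L[ℝ] (Fin t → E l)) k
      fun q => evalTuple l m t (b q) :=
    contMDiff_clm_apply (V := Fin t → E m) (W := (E m →L[ℝ] E l) →L[ℝ] (Fin t → E l))
      (evalTuple l m t) hb
  have hsurj : ∀ q, Function.Surjective (evalTuple l m t (b q)) := fun q =>
    surjective_evalTuple (hpos q.1 fun i j h => by_contra fun hij => q.2 i j hij h)
  have hdim' : finrank ℝ (Fin (t + 1) → E n) + 1 ≤ k + finrank ℝ (Fin t → E l) := by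
    rw [finrank_pi_fintype, finrank_pi_fintype]
    simpa using hdim
  have : IsManifold (powModel n (t + 1)) k (Fin (t + 1) → N) :=
    isManifold_pi (fun _ => 𝓡 n) (fun _ => N)
  have : IsManifold (powModel n (t + 1)) k (distinctTuples N (t + 1)) := inferInstance
  have : (powModel n (t + 1)).Boundaryless := inferInstance
  have key := isNull_setOf_exists_mfderiv_critical_zero (B := Fin (t + 1) → E n)
    (I := powModel n (t + 1)) (Y := Fin t → E l) (P := E m →L[ℝ] E l) hk hdim' hG hA hsurj
  refine key.mono ?_
  intro π hπ
  by_contra hreg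
  refine hπ (isTransverse_diagonal (g := fun q => g₀ q + π (f q)) ?_ fun q hq => ?_)
  · have hπf : ContMDiff (𝓡 n) 𝓘(ℝ, E l) k fun q => π (f q) :=
      contMDiff_clm_apply (V := E m) (W := E l) π hf
    exact (contMDiff_multiMap (hg₀.add hπf) _).mdifferentiable hk'
  have heq : (fun q => differences l t (multiMap (fun q => g₀ q + π (f q)) (t + 1) q)) =
      fun q => differences l t (multiMap g₀ (t + 1) q) + evalTuple l m t (b q) π := by
    funext q i
    simp only [differences_apply, multiMap, Pi.add_apply, evalTuple_apply, b, map_sub]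
    abel
  rw [heq]
  rw [congrFun heq q] at hq
  by_contra hns
  exact hreg ⟨q, hq, hns⟩

/-- Taking coefficients is a linear, hence Lipschitz, mapping between spaces of equal dimension. -/
theorem isLebesgueNull_of_isNull {S : Set (E m →L[ℝ] E l)} (hS : IsNull S) :
    IsLebesgueNull {π : E m →ₗ[ℝ] E l | LinearMap.toContinuousLinearMap π ∈ S} := by
  let L : (E m →L[ℝ] E l) →L[ℝ] (Fin l → Fin m → ℝ) := LinearMap.toContinuousLinearMap
    { toFun := fun π => coefficients (π : E m →ₗ[ℝ] E l)
      map_add' := fun _ _ => rfl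
      map_smul' := fun _ _ => rfl }
  have hd : finrank ℝ (E m →L[ℝ] E l) = finrank ℝ (Fin l → Fin m → ℝ) := by
    rw [← (LinearMap.toContinuousLinearMap (𝕜 := ℝ) (E := E m) (F' := E l)).finrank_eq]
    simp [finrank_linearMap, finrank_pi_fintype, mul_comm]
  refine measure_mono_null ?_ ((isNull_iff volume).1 (hS.image L hd))
  rintro _ ⟨π, hπ, rfl⟩
  exact ⟨_, hπ, rfl⟩

theorem le_sZero {n l sf s : ℕ} (hs : 2 ≤ s) (hsf : s ≤ sf) :
    (s : ℤ) * ((n : ℤ) - (l : ℤ)) + (l : ℤ) ≤ sZero n l sf :=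
  le_csSup ((finite_Icc 2 sf).image _).bddAbove ⟨s, ⟨hs, hsf⟩, rfl⟩

end Perturbation

end LinearPerturbation

end

/-! ### The exceptional set and the proof of both conclusions -/

theorem mainTheorem2 {n m l : ℕ} (hn : 0 < n) (hm : 0 < m) (hl : 0 < l) (r : ℕ∞)
    {N : Type*} [TopologicalSpace N] [T2Space N] [SecondCountableTopology N] [Nonempty N]
    [ChartedSpace (LinearPerturbation.E n) N] [IsManifold (𝓡 n) r N]
    (U : Set (LinearPerturbation.E m)) (hU : IsOpen U)
    (f : N → LinearPerturbation.E m) (hfU : ∀ q, f q ∈ U)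
    (hf : ContMDiff (𝓡 n) 𝓘(ℝ, LinearPerturbation.E m) r f) (hinj : Function.Injective f)
    (F : LinearPerturbation.E m → LinearPerturbation.E l) (hF : ContDiffOn ℝ r F U)
    (hr : ((max (LinearPerturbation.sZero n l (LinearPerturbation.sMax f)) 0).toNat : ℕ∞) < r) :
    ∃ S : Set (LinearPerturbation.E m →ₗ[ℝ] LinearPerturbation.E l),
      LinearPerturbation.IsLebesgueNull S ∧
      ∀ π : LinearPerturbation.E m →ₗ[ℝ] LinearPerturbation.E l, π ∉ S →
        (∀ s : ℕ, 2 ≤ s → s ≤ LinearPerturbation.sMax f →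
          ContMDiff (LinearPerturbation.powModel n s)
            𝓘(ℝ, Fin s → LinearPerturbation.E l) r
            (LinearPerturbation.multiMap (fun q => F (f q) + π (f q)) s) ∧
          LinearPerturbation.IsTransverse (LinearPerturbation.powModel n s)
            (LinearPerturbation.multiMap (fun q => F (f q) + π (f q)) s)
            (LinearPerturbation.diagonal l s)) ∧
        ((∀ y : LinearPerturbation.E l,
            {x | x ∈ U ∧ F x + π x = y}.encard ≤ (LinearPerturbation.sMax f : ℕ∞)) →
          ContMDiff (𝓡 n) 𝓘(ℝ, LinearPerturbation.E l) r (fun q => F (f q) + π (f q)) ∧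
          LinearPerturbation.HasNormalCrossings (n := n) (fun q => F (f q) + π (f q))) := by

  open LinearPerturbation in
  have hinf := infinite_of_chartedSpace hn N
  -- A finite order of differentiability, at most `r` even when `r = ∞`, that meets the requirement
  -- of Sard's theorem for every `s` up to `s_f`.
  set k := (max (sZero n l (sMax f)) 0).toNat + 1 with hkdef
  have hkr : (k : ℕ∞) ≤ r := by
    rw [hkdef, Nat.cast_add, Nat.cast_one]
    exact Order.add_one_le_of_lt hr
  have hkr' : ((k : ℕ∞) : WithTop ℕ∞) ≤ r := by exact_mod_cast hkr
  have hk0 : k ≠ 0 := Nat.succ_ne_zero _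
  have h1r : (1 : WithTop ℕ∞) ≤ r :=
    le_trans (by exact_mod_cast Nat.one_le_iff_ne_zero.2 hk0) hkr'
  have : IsManifold (𝓡 n) k N := IsManifold.of_le hkr'
  have hFf : ContMDiff (𝓡 n) 𝓘(ℝ, E l) r fun q => F (f q) :=
    hF.contMDiffOn.comp_contMDiff hf hfU
  have hg : ∀ π : E m →ₗ[ℝ] E l, ContMDiff (𝓡 n) 𝓘(ℝ, E l) r fun q => F (f q) + π (f q) :=
    fun π => by
      have hπf : ContMDiff (𝓡 n) 𝓘(ℝ, E l) r fun q => LinearMap.toContinuousLinearMap π (f q) :=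
        contMDiff_clm_apply (V := E m) (W := E l) _ hf
      exact hFf.add hπf
  let Bad : ℕ → Set (E m →L[ℝ] E l) := fun t => {π | ¬ IsTransverse (powModel n (t + 1))
      (multiMap (fun q => F (f q) + π (f q)) (t + 1)) (diagonal l (t + 1))}
  have hBad : IsNull (⋃ t ∈ Set.Ico 1 (sMax f), Bad t) := by
    refine IsNull.biUnion (Set.finite_Ico _ _).countable fun t ht => ?_
    refine isNull_setOf_not_isTransverse hk0 ?_ (hf.of_le hkr') (hFf.of_le hkr')
      (inGeneralPosition_of_lt_sMax ht.2)
    -- With `s = t + 1`, the goal is `s (n - ℓ) + ℓ + 1 ≤ k` with the products expanded.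
    have h1 := le_sZero (n := n) (l := l) (Nat.succ_le_succ ht.1) (Nat.succ_le_of_lt ht.2)
    have h2 : sZero n l (sMax f) ≤ (max (sZero n l (sMax f)) 0).toNat :=
      (le_max_left _ _).trans (Int.self_le_toNat _)
    zify
    rw [hkdef]
    push_cast at h1 h2 ⊢
    linarith
  refine ⟨_, isLebesgueNull_of_isNull hBad, fun π hπ => ?_⟩
  have hpart1 : ∀ s : ℕ, 2 ≤ s → s ≤ sMax f → IsTransverse (powModel n s)
      (multiMap (fun q => F (f q) + π (f q)) s) (diagonal l s) := by
    intro s hs hsf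
    obtain ⟨t, rfl⟩ : ∃ t, s = t + 1 := ⟨s - 1, by omega⟩
    by_contra hns
    exact hπ (Set.mem_iUnion₂.2 ⟨t, ⟨by omega, by omega⟩, hns⟩)
  refine ⟨fun s hs hsf => ⟨contMDiff_multiMap (hg π) s, hpart1 s hs hsf⟩, fun hcard =>
    ⟨hg π, (hg π).of_le h1r, fun s hs => ?_⟩⟩
  by_cases hsf : s ≤ sMax f
  · exact hpart1 s hs hsf
  -- Transversality is vacuous here: `f ∘ q` would give `s > s_f` distinct points in one fibre of
  -- `F_π`.
  rintro q ⟨y, hy⟩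
  have hqinj : Function.Injective q.1 := fun i j h => by_contra fun hij => q.2 i j hij h
  have hsub : Set.range (f ∘ q.1) ⊆ {x | x ∈ U ∧ F x + π x = y} := by
    rintro _ ⟨i, rfl⟩
    exact ⟨hfU _, congrFun hy i⟩
  have h1 := (Set.encard_le_encard hsub).trans (hcard y)
  rw [← Set.image_univ, (hinj.comp hqinj).encard_image, Set.encard_univ,
    ENat.card_eq_coe_fintype_card, Fintype.card_fin] at h1
  exact (hsf (by exact_mod_cast h1)).elim
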